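/- **Lemma (Quantum Frank–Wolfe update over a latent group norm ball).** Let $\mathcal G=\{\mathbf g_1,\dots,\mathbf g_{|\mathcal G|}\}$ be a finite non-empty family of subsets of $[d]$ with $\bigcup_i\mathbf g_i=[d]$ (not necessarily disjoint). For each $i$ let $p_i\in[1,\infty]$, let $\|\cdot\|_{\mathbf g_i}$ be the $\ell_{p_i}$ norm on $\mathbb R^{\mathbf g_i}$, with dual norm $\|y\|_{\mathbf g_i}^*=\max\{\langle v,y\rangle:\|v\|_{\mathbf g_i}\le1\}$, and let $$\|x\|_{\mathcal G}=\min\Big\{\sum_i\|v_i\|_{\mathbf g_i}\;:\;v_i\in\mathbb R^{\mathbf g_i},\ x=\sum_i v_{i}^{\uparrow}\Big\}$$ be the latent group norm on $\mathbb R^d$, where $v_i^{\uparrow}\in\mathbb R^d$ is the extension of $v_i$ by zero outside $\mathbf g_i$. Let $B=\{s\in\mathbb R^d:\|s\|_{\mathcal G}\le 1\}$, $\|y\|_{\mathcal G}^*=\max_{s\in B}\langle s,y\rangle$ and $|\mathbf g|_{\max}=\max_i|\mathbf g_i|$. Then $$\|y\|_{\mathcal G}^*=\max_{i}\|y_{(\mathbf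 g_i)}\|_{\mathbf g_i}^*\qquad\text{for all }y\in\mathbb R^d,$$ where $y_{(\mathbf g_i)}$ is the restriction of $y$ to the coordinates in $\mathbf g_i$. Moreover, there is an absolute constant $C>0$ such that for all such $d,\mathcal G,(p_i)$, every step $\sigma>0$ and every failure probability $\delta\in(0,1/2]$ there is a quantum algorithm making at most $C\sqrt{|\mathcal G|}\,|\mathbf g|_{\max}\log(1/\delta)$ calls to the oracle (hence $O(\sqrt{|\mathcal G|}\,|\mathbf g|_{\max})$ calls for a fixed success probability) with the following property. For every function $f:\mathbb R^d\to\mathbb R$, accessed only through the oracle $U_f:|x\rangle|a\rangle\mapsto|x\rangle|a+f(x)\rangle$ (registers holding exact real numbers), and for every input $x\in\mathbb R^d$, it returns with probability at least $1-\delta$ a vector $$s^*\in\operatorname*{arg\,max}_{s\in B}\ \langle s,g(x)\rangle ,\qquad g_i(x)=\frac{f(x+\sigma e_i)-f(x)}{\sigma}.$$ In particular, if the gradient estimate is exact, i.e. $f$ is differentiable at $x$ and $g(x)=\nabla f(x)$, then with probability at least $1-\delta$ the vector returned satisfies $s^*\in B$ and $\langle s^*,\nabla f(x)\rangle=\|\nabla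 f(x)\|_{\mathcal G}^*$, and $-s^*$ solves the Frank–Wolfe linear subproblem $\min_{s\in B}\langle s,\nabla f(x)\rangle$. Here a quantum algorithm is a sequence, finite on every branch, of unitaries that do not depend on $f$ or $x$, calls to $U_f$, and (partial) measurements in the computational basis on whose outcomes the later steps may depend, started in $|x\rangle|0\rangle|w_0\rangle$; the number of calls is counted in the worst case over all measurement outcomes. -/

import Mathlib

open scoped ENNReal

noncomputable section

/-! ## Latent group norms -/

/-- The `ℓ_p` norm on `ℝ^s`, for a set `s` of coordinates. -/
def groupNorm {d : ℕ} (s : Finset (Fin d)) (p : ℝ≥0∞) (v : s → ℝ) : ℝ :=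
  ‖(WithLp.toLp p v : PiLp p fun _ : s => ℝ)‖

/-- The vector of `ℝ^d` that agrees with `v` on `s` and vanishes outside `s`. -/
def extendZero {d : ℕ} (s : Finset (Fin d)) (v : s → ℝ) : EuclideanSpace ℝ (Fin d) :=
  WithLp.toLp 2 fun j => if h : j ∈ s then v ⟨j, h⟩ else 0

/-- The restriction of `y ∈ ℝ^d` to the coordinates in `s`. -/
def restrictTo {d : ℕ} (s : Finset (Fin d)) (y : EuclideanSpace ℝ (Fin d)) : s → ℝ :=
  fun j => y j

/-- The latent group norm of the family of groups `g i` carrying the `ℓ_{p i}` norms: the least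
value of `∑ i, ‖v i‖_{p i}` over all decompositions of `x` into vectors `v i` supported on `g i`. -/
def latentGroupNorm {d n : ℕ} (g : Fin n → Finset (Fin d)) (p : Fin n → ℝ≥0∞)
    (x : EuclideanSpace ℝ (Fin d)) : ℝ :=
  sInf {r : ℝ | ∃ v : (i : Fin n) → (g i → ℝ),
    x = ∑ i, extendZero (g i) (v i) ∧ r = ∑ i, groupNorm (g i) (p i) (v i)}

/-- The unit ball of the latent group norm. -/
def latentGroupBall {d n : ℕ} (g : Fin n → Finset (Fin d)) (p : Fin n → ℝ≥0∞) :
    Set (EuclideanSpace ℝ (Fin d)) :=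
  {s | latentGroupNorm g p s ≤ 1}

/-- The dual of the latent group norm. -/
def latentGroupDualNorm {d n : ℕ} (g : Fin n → Finset (Fin d)) (p : Fin n → ℝ≥0∞)
    (y : EuclideanSpace ℝ (Fin d)) : ℝ :=
  sSup {r : ℝ | ∃ s : EuclideanSpace ℝ (Fin d), latentGroupNorm g p s ≤ 1 ∧ r = inner ℝ s y}

/-- The dual of the `ℓ_p` norm on `ℝ^s`. -/
def groupDualNorm {d : ℕ} (s : Finset (Fin d)) (p : ℝ≥0∞) (y : s → ℝ) : ℝ :=
  sSup {r : ℝ | ∃ v : s → ℝ, groupNorm s p v ≤ 1 ∧ r = ∑ j, v j * y j}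

/-- The largest size of a group. -/
def maxGroupSize {d n : ℕ} (g : Fin n → Finset (Fin d)) : ℕ :=
  Finset.univ.sup fun i => (g i).card

/-- The forward-difference estimate of the gradient of `f` at `x`, with step `σ`. -/
def forwardDiff {d : ℕ} (f : EuclideanSpace ℝ (Fin d) → ℝ) (σ : ℝ)
    (x : EuclideanSpace ℝ (Fin d)) : EuclideanSpace ℝ (Fin d) :=
  WithLp.toLp 2 fun i => (f (x + σ • EuclideanSpace.single i (1 : ℝ)) - f x) / σ

/-! ## Quantum algorithms with access to a function-value oracle -/

/-- The Hilbert space with the orthonormal basis `|b⟩`, `b : B`. -/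
abbrev QState (B : Type) : Type := lp (fun _ : B => ℂ) 2

/-- A function that is pointwise at most a square-summable function is square-summable. -/
theorem QState.memlp_of_le {B : Type} (ψ : QState B) (φ : B → ℂ) (h : ∀ b, ‖φ b‖ ≤ ‖ψ b‖) :
    Memℓp φ 2 := by
  have h2 : (0 : ℝ) < (2 : ℝ≥0∞).toReal := by norm_num
  refine memℓp_gen (Summable.of_nonneg_of_le (fun b => by positivity) (fun b => ?_)
    ((lp.memℓp ψ).summable h2))
  exact Real.rpow_le_rpow (norm_nonneg _) (h b) h2.le

/-- Permuting the basis keeps a function square-summable. -/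
theorem QState.memlp_comp {B : Type} (ψ : QState B) (e : Equiv.Perm B) :
    Memℓp (fun b => ψ (e b)) 2 := by
  have h2 : (0 : ℝ) < (2 : ℝ≥0∞).toReal := by norm_num
  exact memℓp_gen (e.summable_iff.mpr ((lp.memℓp ψ).summable h2))

/-- The unitary that permutes the computational basis: `|b⟩ ↦ |e b⟩`. -/
def permUnitary {B : Type} (e : Equiv.Perm B) : QState B ≃ₗᵢ[ℂ] QState B where
  toFun ψ := ⟨fun b => ψ (e.symm b), QState.memlp_comp ψ e.symm⟩
  invFun ψ := ⟨fun b => ψ (e b), QState.memlp_comp ψ e⟩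
  map_add' _ _ := rfl
  map_smul' _ _ := rfl
  left_inv ψ := by ext b; simp
  right_inv ψ := by ext b; simp
  norm_map' ψ := by
    have h2 : (0 : ℝ) < (2 : ℝ≥0∞).toReal := by norm_num
    rw [lp.norm_eq_tsum_rpow h2, lp.norm_eq_tsum_rpow h2]
    congr 1
    exact e.symm.tsum_eq fun b => ‖ψ b‖ ^ (2 : ℝ≥0∞).toReal

open Classical in
/-- The computational basis state `|b⟩`. -/
def basisState {B : Type} (b : B) : QState B := lp.single 2 b (1 : ℂ)

open Classical in
/-- The (unnormalised) state after the measurement of the computational-basis observable `m`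
has given the outcome `a`. -/
def collapse {B α : Type} (m : B → α) (a : α) (ψ : QState B) : QState B :=
  ⟨fun b => if m b = a then ψ b else 0,
    QState.memlp_of_le ψ _ fun b => by split_ifs <;> simp⟩

/-- Basis labels `|x⟩|a⟩|w⟩`: a query register holding a point of `ℝ^d`, an answer register holding
a real number, and a work register with label set `W`. -/
abbrev Registers (d : ℕ) (W : Type) : Type := EuclideanSpace ℝ (Fin d) × ℝ × W

/-- The permutation `(x, a, w) ↦ (x, a + f x, w)` of the basis labels. -/
def oraclePerm {d : ℕ} (W : Type) (f : EuclideanSpace ℝ (Fin d) → ℝ) :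
    Equiv.Perm (Registers d W) where
  toFun b := (b.1, b.2.1 + f b.1, b.2.2)
  invFun b := (b.1, b.2.1 - f b.1, b.2.2)
  left_inv b := by simp
  right_inv b := by simp

/-- The function-value oracle `U_f : |x⟩|a⟩ ↦ |x⟩|a + f(x)⟩`. -/
def oracle {d : ℕ} (W : Type) (f : EuclideanSpace ℝ (Fin d) → ℝ) :
    QState (Registers d W) ≃ₗᵢ[ℂ] QState (Registers d W) :=
  permUnitary (oraclePerm W f)

/-- Quantum programs that access a function only through calls to its oracle. Each step applies a
unitary that does not involve the function, calls the oracle, or measures an observable `m` of the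
computational basis and continues depending on the outcome. At the end all registers are measured
in the computational basis, and the result `out b` is computed from the outcome `b`. -/
inductive QProgram (d : ℕ) (W : Type) (R : Type) : Type 1
  | done (out : Registers d W → R) : QProgram d W R
  | unitary (U : QState (Registers d W) ≃ₗᵢ[ℂ] QState (Registers d W))
      (next : QProgram d W R) : QProgram d W R
  | query (next : QProgram d W R) : QProgram d W R
  | measure {α : Type} (m : Registers d W → α) (next : α → QProgram d W R) : QProgram d W R

/-- The largest number of oracle calls on a branch of the program. -/
def QProgram.queries {d : ℕ} {W R : Type} : QProgram d W R → ℕ∞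
  | .done _ => 0
  | .unitary _ next => next.queries
  | .query next => next.queries + 1
  | .measure _ next => ⨆ a, (next a).queries

open Classical in
/-- The probability that the program, started in the state `ψ` and run with the oracle of `f`,
returns a result in `S` (for an unnormalised `ψ`, this probability times `‖ψ‖ ^ 2`). -/
def QProgram.prob {d : ℕ} {W R : Type} (f : EuclideanSpace ℝ (Fin d) → ℝ) (S : Set R) :
    QProgram d W R → QState (Registers d W) → ℝ≥0∞
  | .done out, ψ => ∑' b, if out b ∈ S then ‖ψ b‖ₑ ^ 2 else 0
  | .unitary U next, ψ => next.prob f S (U ψ)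
  | .query next, ψ => next.prob f S (oracle W f ψ)
  | .measure m next, ψ => ∑' a, (next a).prob f S (collapse m a ψ)

/-- A quantum algorithm that takes a point of `ℝ^d` as its input, has access to a function-value
oracle, and returns an element of `R`. -/
structure QAlgorithm (d : ℕ) (R : Type) where
  /-- the labels of the work register -/
  Work : Type
  /-- the initial content of the work register -/
  init : Work
  /-- the program -/
  program : QProgram d Work R

/-- The worst-case number of calls to the oracle. -/
def QAlgorithm.queries {d : ℕ} {R : Type} (A : QAlgorithm d R) : ℕ∞ := A.program.queries

/-- The probability that the algorithm, started in `|x⟩|0⟩|init⟩` and run with the oracle of `f`,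
returns a result in `S`. -/
def QAlgorithm.prob {d : ℕ} {R : Type} (A : QAlgorithm d R)
    (f : EuclideanSpace ℝ (Fin d) → ℝ) (x : EuclideanSpace ℝ (Fin d)) (S : Set R) : ℝ≥0∞ :=
  A.program.prob f S (basisState (x, 0, A.init))

end

/-! ## Duality for latent group norms -/

section Norms

variable {d n : ℕ}

/-! Duality: pairing any latent decomposition of `s` with `y` and applying Hölder group by group
bounds `⟨s, y⟩` by the latent norm of `s` times the largest group dual norm. An optimal dual vector
of a maximising group, extended by zero, attains this bound. The linear problem over the ball is
thus the task of finding the maximum of `n` scores, each computable from at most `maxGroupSize g +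
1` values of `f`.

The maximum is found by Grover search with a classically stored champion: mark the indices that beat
it, make `k` iterations, measure a challenger, keep the better one. Full measurements reduce the run
to the Markov chain `chainProb`, whose transition weights are squared Grover amplitudes.

A predetermined schedule avoids an extra logarithm in `n`. While the champion is among the top `n /
9 ^ l`, iterations with `2 * k + 1 = 3 ^ l` do not overshoot and reach the top `n / 9 ^ (l + 1)`
with constant probability (`le_sum_groverAmp_sq_topSet`). With `j` phases left, the phase is
repeated `j * M` times: failures are at most `q ^ j` and sum to at most `2 * q`, while costs `j * M
* 3 ^ (L - j)` sum to `O(M * 3 ^ L)`, that is, `O(√n * log (1 / δ))` rounds of evaluation. -/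

theorem groupNorm_nonneg (s : Finset (Fin d)) {p : ℝ≥0∞} (hp : 1 ≤ p) (v : s → ℝ) :
    0 ≤ groupNorm s p v := by
  have : Fact (1 ≤ p) := ⟨hp⟩
  exact norm_nonneg _

theorem groupNorm_zero (s : Finset (Fin d)) {p : ℝ≥0∞} (hp : 1 ≤ p) :
    groupNorm s p 0 = 0 := by
  have : Fact (1 ≤ p) := ⟨hp⟩
  exact norm_zero

theorem groupNorm_smul (s : Finset (Fin d)) {p : ℝ≥0∞} (hp : 1 ≤ p) (c : ℝ) (v : s → ℝ) :
    groupNorm s p (c • v) = |c| * groupNorm s p v := by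
  have : Fact (1 ≤ p) := ⟨hp⟩
  exact norm_smul c (WithLp.toLp p v : PiLp p fun _ : s => ℝ)

theorem groupNorm_eq_zero (s : Finset (Fin d)) {p : ℝ≥0∞} (hp : 1 ≤ p) {v : s → ℝ}
    (h : groupNorm s p v = 0) : v = 0 := by
  have : Fact (1 ≤ p) := ⟨hp⟩
  have := norm_eq_zero.mp h
  exact congrArg WithLp.ofLp this

/-- The supremum that defines the dual norm of `y` is attained. -/
theorem exists_isGreatest_groupDualNorm (s : Finset (Fin d)) {p : ℝ≥0∞} (hp : 1 ≤ p)
    (y : s → ℝ) :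
    ∃ v : s → ℝ, groupNorm s p v ≤ 1 ∧ ∑ j, v j * y j = groupDualNorm s p y ∧
      ∀ w : s → ℝ, groupNorm s p w ≤ 1 → ∑ j, w j * y j ≤ groupDualNorm s p y := by
  have : Fact (1 ≤ p) := ⟨hp⟩
  have hc : Continuous fun w : PiLp p (fun _ : s => ℝ) => ∑ j, w j * y j := by fun_prop
  obtain ⟨v, hv, hmax⟩ := (isCompact_closedBall (0 : PiLp p fun _ : s => ℝ) 1).exists_isMaxOn
    ⟨0, by simp⟩ hc.continuousOn
  have hv1 : ‖v‖ ≤ 1 := by simpa using hv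
  have hle : ∀ w : s → ℝ, groupNorm s p w ≤ 1 → ∑ j, w j * y j ≤ ∑ j, v j * y j := by
    intro w hw
    have hw' : (WithLp.toLp p w : PiLp p fun _ : s => ℝ) ∈ Metric.closedBall 0 1 := by
      simpa [groupNorm] using hw
    exact hmax hw'
  have hG : IsGreatest {r : ℝ | ∃ v : s → ℝ, groupNorm s p v ≤ 1 ∧ r = ∑ j, v j * y j}
      (∑ j, v j * y j) :=
    ⟨⟨v.ofLp, hv1, rfl⟩, by rintro r ⟨w, hw, rfl⟩; exact hle w hw⟩
  have hE : groupDualNorm s p y = ∑ j, v j * y j := hG.csSup_eq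
  exact ⟨v.ofLp, hv1, hE.symm, fun w hw => hE ▸ hle w hw⟩

theorem groupDualNorm_nonneg (s : Finset (Fin d)) {p : ℝ≥0∞} (hp : 1 ≤ p) (y : s → ℝ) :
    0 ≤ groupDualNorm s p y := by
  obtain ⟨v, -, -, h⟩ := exists_isGreatest_groupDualNorm s hp y
  simpa using h 0 (by rw [groupNorm_zero s hp]; exact zero_le_one)

/-- Hölder's inequality for a norm and its dual. -/
theorem sum_mul_le_groupNorm_mul (s : Finset (Fin d)) {p : ℝ≥0∞} (hp : 1 ≤ p) (v y : s → ℝ) :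
    ∑ j, v j * y j ≤ groupNorm s p v * groupDualNorm s p y := by
  obtain ⟨-, -, -, h⟩ := exists_isGreatest_groupDualNorm s hp y
  rcases (groupNorm_nonneg s hp v).eq_or_lt with h0 | h0
  · rw [groupNorm_eq_zero s hp h0.symm, groupNorm_zero s hp]
    simp
  · have := h ((groupNorm s p v)⁻¹ • v) (by
      rw [groupNorm_smul s hp, abs_of_pos (inv_pos.mpr h0), inv_mul_cancel₀ h0.ne'])
    have h2 : ∑ j, ((groupNorm s p v)⁻¹ • v) j * y j = (groupNorm s p v)⁻¹ * ∑ j, v j * y j := by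
      simp [Finset.mul_sum, mul_assoc]
    rw [h2, inv_mul_le_iff₀ h0] at this
    exact this

theorem inner_extendZero (s : Finset (Fin d)) (v : s → ℝ) (y : EuclideanSpace ℝ (Fin d)) :
    inner ℝ (extendZero s v) y = ∑ j, v j * restrictTo s y j := by
  simp only [PiLp.inner_apply, extendZero, restrictTo]
  rw [← Finset.sum_subset (Finset.subset_univ s), ← Finset.sum_attach]
  · simp [mul_comm]
  · intro j _ hj
    simp [hj]

theorem latentGroupNorm_set_bddBelow (g : Fin n → Finset (Fin d)) {p : Fin n → ℝ≥0∞}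
    (hp : ∀ i, 1 ≤ p i) (x : EuclideanSpace ℝ (Fin d)) :
    BddBelow {r : ℝ | ∃ v : (i : Fin n) → (g i → ℝ),
      x = ∑ i, extendZero (g i) (v i) ∧ r = ∑ i, groupNorm (g i) (p i) (v i)} := by
  refine ⟨0, ?_⟩
  rintro r ⟨v, -, rfl⟩
  exact Finset.sum_nonneg fun i _ => groupNorm_nonneg _ (hp i) _

theorem extendZero_zero (s : Finset (Fin d)) : extendZero s 0 = 0 := by
  ext j
  simp [extendZero]

theorem latentGroupNorm_extendZero_le (g : Fin n → Finset (Fin d)) {p : Fin n → ℝ≥0∞}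
    (hp : ∀ i, 1 ≤ p i) (i : Fin n) (v : g i → ℝ) :
    latentGroupNorm g p (extendZero (g i) v) ≤ groupNorm (g i) (p i) v := by
  refine csInf_le (latentGroupNorm_set_bddBelow g hp _)
    ⟨Function.update (fun _ => 0) i v, ?_, ?_⟩
  · rw [Finset.sum_eq_single i]
    · simp
    · intro k _ hk
      rw [Function.update_of_ne hk]
      exact extendZero_zero _
    · simp
  · rw [Finset.sum_eq_single i]
    · simp
    · intro k _ hk
      rw [Function.update_of_ne hk]
      exact groupNorm_zero _ (hp k)
    · simp

/-- When the groups cover all coordinates, every vector has a latent decomposition. -/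
theorem exists_latent_decomposition (g : Fin n → Finset (Fin d))
    (hg : ∀ j : Fin d, ∃ i : Fin n, j ∈ g i) (x : EuclideanSpace ℝ (Fin d)) :
    ∃ v : (i : Fin n) → (g i → ℝ), x = ∑ i, extendZero (g i) (v i) := by
  choose c hc using hg
  refine ⟨fun i j => if c j = i then x j else 0, ?_⟩
  ext j
  rw [WithLp.ofLp_sum, Finset.sum_apply, Finset.sum_eq_single (c j)]
  · simp [extendZero, hc]
  · intro i _ hi
    simp [extendZero, hi.symm]
  · simp

/-- Hölder on each summand gives the bound for every decomposition; passing to the infimum divides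
by `M`, hence the separate case `M = 0`. The covering hypothesis makes the set of decompositions
non-empty, so that the infimum is meaningful. -/
theorem inner_le_of_latentGroupNorm_le_one (g : Fin n → Finset (Fin d)) {p : Fin n → ℝ≥0∞}
    (hg : ∀ j : Fin d, ∃ i : Fin n, j ∈ g i) (hp : ∀ i, 1 ≤ p i)
    {s y : EuclideanSpace ℝ (Fin d)} (hs : latentGroupNorm g p s ≤ 1) {M : ℝ} (hM : 0 ≤ M)
    (hy : ∀ i, groupDualNorm (g i) (p i) (restrictTo (g i) y) ≤ M) : inner ℝ s y ≤ M := by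
  have key : ∀ r ∈ {r : ℝ | ∃ v : (i : Fin n) → (g i → ℝ),
      s = ∑ i, extendZero (g i) (v i) ∧ r = ∑ i, groupNorm (g i) (p i) (v i)},
      inner ℝ s y ≤ r * M := by
    rintro r ⟨v, hv, rfl⟩
    rw [hv, sum_inner, Finset.sum_mul]
    refine Finset.sum_le_sum fun i _ => ?_
    rw [inner_extendZero]
    exact (sum_mul_le_groupNorm_mul _ (hp i) _ _).trans
      (mul_le_mul_of_nonneg_left (hy i) (groupNorm_nonneg _ (hp i) _))
  obtain ⟨v, hv⟩ := exists_latent_decomposition g hg s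
  rcases hM.eq_or_lt with rfl | hM
  · simpa using key _ ⟨v, hv, rfl⟩
  · have h1 : inner ℝ s y / M ≤ latentGroupNorm g p s :=
      le_csInf ⟨_, v, hv, rfl⟩ fun r hr => (div_le_iff₀ hM).mpr (key r hr)
    simpa using (div_le_iff₀ hM).mp (h1.trans hs)

/-- A dual vector of a group of greatest dual norm is optimal over the latent group ball. -/
theorem isGreatest_inner_extendZero (g : Fin n → Finset (Fin d)) {p : Fin n → ℝ≥0∞}
    (hg : ∀ j : Fin d, ∃ i : Fin n, j ∈ g i) (hp : ∀ i, 1 ≤ p i) (y : EuclideanSpace ℝ (Fin d))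
    {i : Fin n} (hi : ∀ k, groupDualNorm (g k) (p k) (restrictTo (g k) y) ≤
      groupDualNorm (g i) (p i) (restrictTo (g i) y))
    {v : g i → ℝ} (hv : groupNorm (g i) (p i) v ≤ 1)
    (hvy : ∑ j, v j * restrictTo (g i) y j = groupDualNorm (g i) (p i) (restrictTo (g i) y)) :
    latentGroupNorm g p (extendZero (g i) v) ≤ 1 ∧
    inner ℝ (extendZero (g i) v) y = groupDualNorm (g i) (p i) (restrictTo (g i) y) ∧
    IsGreatest {r : ℝ | ∃ s : EuclideanSpace ℝ (Fin d),
      latentGroupNorm g p s ≤ 1 ∧ r = inner ℝ s y}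
      (groupDualNorm (g i) (p i) (restrictTo (g i) y)) := by
  have h1 := (latentGroupNorm_extendZero_le g hp i v).trans hv
  have h2 := (inner_extendZero (g i) v y).trans hvy
  refine ⟨h1, h2, ⟨_, h1, h2.symm⟩, ?_⟩
  rintro r ⟨s, hs, rfl⟩
  exact inner_le_of_latentGroupNorm_le_one g hg hp hs (groupDualNorm_nonneg _ (hp i) _) hi

theorem isGreatest_latentGroupDualNorm (g : Fin n → Finset (Fin d)) {p : Fin n → ℝ≥0∞}
    (hn : 0 < n) (hg : ∀ j : Fin d, ∃ i : Fin n, j ∈ g i) (hp : ∀ i, 1 ≤ p i)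
    (y : EuclideanSpace ℝ (Fin d)) :
    IsGreatest (Set.range fun i : Fin n => groupDualNorm (g i) (p i) (restrictTo (g i) y))
      (latentGroupDualNorm g p y) := by
  have : Nonempty (Fin n) := ⟨⟨0, hn⟩⟩
  obtain ⟨i, hi⟩ := Finite.exists_max fun i : Fin n =>
    groupDualNorm (g i) (p i) (restrictTo (g i) y)
  obtain ⟨v, hv, hvy, -⟩ := exists_isGreatest_groupDualNorm (g i) (hp i) (restrictTo (g i) y)
  have h : latentGroupDualNorm g p y = groupDualNorm (g i) (p i) (restrictTo (g i) y) :=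
    (isGreatest_inner_extendZero g hg hp y hi hv hvy).2.2.csSup_eq
  rw [h]
  exact ⟨⟨i, rfl⟩, by rintro _ ⟨k, rfl⟩; exact hi k⟩

theorem extendZero_neg (s : Finset (Fin d)) (v : s → ℝ) : extendZero s (-v) = -extendZero s v := by
  ext j
  by_cases h : j ∈ s <;> simp [extendZero, h]

theorem groupNorm_neg (s : Finset (Fin d)) {p : ℝ≥0∞} (hp : 1 ≤ p) (v : s → ℝ) :
    groupNorm s p (-v) = groupNorm s p v := by
  simpa using groupNorm_smul s hp (-1) v

theorem latentGroupNorm_neg (g : Fin n → Finset (Fin d)) {p : Fin n → ℝ≥0∞}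
    (hp : ∀ i, 1 ≤ p i) (x : EuclideanSpace ℝ (Fin d)) :
    latentGroupNorm g p (-x) = latentGroupNorm g p x := by
  refine congrArg sInf (Set.ext fun r => ?_)
  refine (Equiv.neg ((i : Fin n) → (g i → ℝ))).exists_congr fun v => ?_
  simp [extendZero_neg, groupNorm_neg _ (hp _), neg_eq_iff_eq_neg]

end Norms

/-! ## A search by amplitude amplification as a Markov chain -/

section Chain

/-- The amplitudes after `k` Grover iterations on the uniform superposition, with marked set `G`. -/
noncomputable def groverAmp {n : ℕ} (G : Finset (Fin n)) : ℕ → Fin n → ℝ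
  | 0, _ => 1 / √n
  | k + 1, i => 2 * ((∑ j, if j ∈ G then -groverAmp G k j else groverAmp G k j) / n) -
      if i ∈ G then -groverAmp G k i else groverAmp G k i

theorem sum_sq_groverAmp {n : ℕ} (hn : 0 < n) (G : Finset (Fin n)) (k : ℕ) :
    ∑ i, groverAmp G k i ^ 2 = 1 := by
  have hn' : (n : ℝ) ≠ 0 := by positivity
  induction k with
  | zero => simp [groverAmp, hn']
  | succ k ih =>
    set u : Fin n → ℝ := fun i => if i ∈ G then -groverAmp G k i else groverAmp G k i with hu
    have hsq : ∑ i, u i ^ 2 = 1 := by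
      rw [← ih]
      refine Finset.sum_congr rfl fun i _ => ?_
      simp only [hu]
      split_ifs <;> ring
    calc ∑ i, groverAmp G (k + 1) i ^ 2 = ∑ i, (2 * ((∑ j, u j) / n) - u i) ^ 2 := rfl
      _ = ∑ i, ((2 * ((∑ j, u j) / n)) ^ 2 - 2 * (2 * ((∑ j, u j) / n)) * u i + u i ^ 2) :=
          Finset.sum_congr rfl fun i _ => by ring
      _ = 1 := by
          rw [Finset.sum_add_distrib, Finset.sum_sub_distrib, ← Finset.mul_sum, hsq]
          simp only [Finset.sum_const, Finset.card_univ, Fintype.card_fin, nsmul_eq_mul]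
          field_simp
          ring

/-- Sign flip followed by reflection about the mean rotates by `2 * θ` in the plane spanned by the
uniform vectors on `G` and on its complement. -/
theorem groverAmp_eq {n : ℕ} {G : Finset (Fin n)} (hG : 0 < G.card) (hGn : G.card < n)
    {θ : ℝ} (hs : Real.sin θ = √G.card / √n) (hc : Real.cos θ = √(n - G.card) / √n) (k : ℕ)
    (i : Fin n) : groverAmp G k i =
      if i ∈ G then Real.sin ((2 * k + 1) * θ) / √G.card
      else Real.cos ((2 * k + 1) * θ) / √(n - G.card) := by
  have hn : (0 : ℝ) < n := by exact_mod_cast hG.trans hGn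
  have ht : (0 : ℝ) < G.card := by exact_mod_cast hG
  have hr : (0 : ℝ) < n - G.card := sub_pos.mpr (by exact_mod_cast hGn)
  have hA : 0 < √(G.card : ℝ) := Real.sqrt_pos.mpr ht
  have hB : 0 < √((n : ℝ) - G.card) := Real.sqrt_pos.mpr hr
  have hN : 0 < √(n : ℝ) := Real.sqrt_pos.mpr hn
  have hA2 : √(G.card : ℝ) ^ 2 = G.card := Real.sq_sqrt ht.le
  have hB2 : √((n : ℝ) - G.card) ^ 2 = n - G.card := Real.sq_sqrt hr.le
  have hN2 : √(n : ℝ) ^ 2 = n := Real.sq_sqrt hn.le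
  induction k generalizing i with
  | zero =>
    simp only [groverAmp, Nat.cast_zero, mul_zero, zero_add, one_mul, hs, hc]
    split_ifs <;> field_simp
  | succ k ih =>
    set S := Real.sin ((2 * k + 1) * θ)
    set K := Real.cos ((2 * k + 1) * θ)
    have hsum : (∑ j, if j ∈ G then -groverAmp G k j else groverAmp G k j) =
        √(n - G.card) * K - √G.card * S := by
      have h1 : ∀ j, (if j ∈ G then -groverAmp G k j else groverAmp G k j) =
          K / √(n - G.card) + if j ∈ G then -(S / √G.card) - K / √(n - G.card) else 0 := by
        intro j
        rw [ih j]
        split_ifs <;> ring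
      rw [Finset.sum_congr rfl fun j _ => h1 j, Finset.sum_add_distrib, Finset.sum_ite_mem]
      simp only [Finset.sum_const, Finset.card_univ, Fintype.card_fin, nsmul_eq_mul,
        Finset.univ_inter]
      rw [mul_sub, mul_neg]
      have e1 : (n : ℝ) * (K / √(n - G.card)) - G.card * (K / √(n - G.card)) =
          √(n - G.card) * K := by
        rw [← sub_mul]; nth_rewrite 1 [← hB2]; field_simp
      have e2 : (G.card : ℝ) * (S / √G.card) = √G.card * S := by
        nth_rewrite 1 [← hA2]; field_simp
      linarith
    have harg : (2 * ((k + 1 : ℕ) : ℝ) + 1) * θ = (2 * k + 1) * θ + 2 * θ := by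
      push_cast; ring
    have hS : Real.sin ((2 * k + 1) * θ + 2 * θ) =
        S * (1 - 2 * (√G.card / √n) ^ 2) + K * (2 * (√G.card / √n) * (√(n - G.card) / √n)) := by
      rw [Real.sin_add, Real.cos_two_mul', Real.sin_two_mul, hs, hc, div_pow, div_pow, hA2, hB2,
        hN2]
      field_simp
      ring
    have hK : Real.cos ((2 * k + 1) * θ + 2 * θ) =
        K * (2 * (√(n - G.card) / √n) ^ 2 - 1) -
          S * (2 * (√G.card / √n) * (√(n - G.card) / √n)) := by
      rw [Real.cos_add, Real.cos_two_mul, Real.sin_two_mul, hs, hc]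
    rw [groverAmp, hsum, ih i, harg, hS, hK]
    have hNn : (n : ℝ) = √n ^ 2 := hN2.symm
    set A := √(G.card : ℝ)
    set B := √((n : ℝ) - G.card)
    set N := √(n : ℝ)
    rw [hNn]
    split_ifs <;> field_simp <;> ring

/-- While the rotation does not overshoot, each marked element has a large amplitude. -/
theorem le_groverAmp_sq {n : ℕ} {G : Finset (Fin n)} (hGn : G.card < n) {k : ℕ}
    (hk : (2 * k + 1) ^ 2 * G.card ≤ n) {i : Fin n} (hi : i ∈ G) :
    4 / Real.pi ^ 2 * ((2 * k + 1) ^ 2 / n) ≤ groverAmp G k i ^ 2 := by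
  have hG : 0 < G.card := Finset.card_pos.mpr ⟨i, hi⟩
  have hn : (0 : ℝ) < n := by exact_mod_cast hG.trans hGn
  have ht : (0 : ℝ) < G.card := by exact_mod_cast hG
  have hA : 0 < √(G.card : ℝ) := Real.sqrt_pos.mpr ht
  have hN : 0 < √(n : ℝ) := Real.sqrt_pos.mpr hn
  have hA2 : √(G.card : ℝ) ^ 2 = G.card := Real.sq_sqrt ht.le
  have hN2 : √(n : ℝ) ^ 2 = n := Real.sq_sqrt hn.le
  set r := √(G.card : ℝ) / √n with hrdef
  have hr0 : 0 < r := by positivity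
  have hr1 : r ≤ 1 := (div_le_one hN).mpr (Real.sqrt_le_sqrt (by exact_mod_cast hGn.le))
  set θ := Real.arcsin r
  have hs : Real.sin θ = r := Real.sin_arcsin (by linarith) hr1
  have hc : Real.cos θ = √(n - G.card) / √n := by
    rw [Real.cos_arcsin, hrdef, div_pow, hA2, hN2, ← Real.sqrt_div' _ hn.le]
    congr 1
    field_simp
  have hθ0 : 0 ≤ θ := Real.arcsin_nonneg.mpr hr0.le
  have hθ1 : θ ≤ Real.pi / 2 := Real.arcsin_le_pi_div_two r
  have hπ := Real.pi_pos
  have hkr : (2 * k + 1) * r ≤ 1 := by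
    have h2 : ((2 * k + 1) * r) ^ 2 ≤ 1 := by
      rw [mul_pow, hrdef, div_pow, hA2, hN2, ← mul_div_assoc, div_le_one hn]
      exact_mod_cast hk
    nlinarith [sq_nonneg ((2 * k + 1) * r - 1), mul_pos (by positivity : (0:ℝ) < 2 * k + 1) hr0]
  have hj := Real.mul_le_sin hθ0 hθ1
  -- Jordan's inequality gives `θ ≤ π / 2 * sin θ`; the final angle therefore stays in the range
  -- where it can be used again to bound the sine from below.
  have hang : (2 * k + 1) * θ ≤ Real.pi / 2 := by
    rw [hs] at hj
    have : θ ≤ Real.pi / 2 * r := by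
      rw [div_mul_eq_mul_div, div_le_iff₀ hπ] at hj
      linarith
    calc (2 * k + 1) * θ ≤ (2 * k + 1) * (Real.pi / 2 * r) :=
          mul_le_mul_of_nonneg_left this (by positivity)
      _ = Real.pi / 2 * ((2 * k + 1) * r) := by ring
      _ ≤ Real.pi / 2 * 1 := mul_le_mul_of_nonneg_left hkr (by positivity)
      _ = _ := mul_one _
  have hsin : 2 / Real.pi * ((2 * k + 1) * r) ≤ Real.sin ((2 * k + 1) * θ) := by
    refine le_trans ?_ (Real.mul_le_sin (by positivity) hang)
    have : r ≤ θ := hs ▸ Real.sin_le hθ0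
    gcongr
  rw [groverAmp_eq hG hGn hs hc, if_pos hi, div_pow, hA2, le_div_iff₀ ht]
  calc 4 / Real.pi ^ 2 * ((2 * k + 1) ^ 2 / n) * G.card
      = (2 / Real.pi * ((2 * k + 1) * r)) ^ 2 := by
        rw [hrdef, mul_pow, mul_pow, div_pow (√(G.card : ℝ)), hA2, hN2]; ring
    _ ≤ _ := pow_le_pow_left₀ (by positivity) hsin 2

/-! ### The champion chain and its progress through the top sets -/

/-- The elements that beat `i`. -/
noncomputable def better {n : ℕ} (h : Fin n → ℝ) (i : Fin n) : Finset (Fin n) :=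
  Finset.univ.filter fun j => h i < h j

theorem mem_better {n : ℕ} {h : Fin n → ℝ} {i j : Fin n} : j ∈ better h i ↔ h i < h j := by
  simp [better]

theorem better_subset {n : ℕ} {h : Fin n → ℝ} {i j : Fin n} (hij : h i ≤ h j) :
    better h j ⊆ better h i := fun a ha => by
  rw [mem_better] at *
  exact hij.trans_lt ha

theorem card_better_lt {n : ℕ} (h : Fin n → ℝ) (i : Fin n) : (better h i).card < n := by
  have : (better h i).card < (Finset.univ : Finset (Fin n)).card :=
    Finset.card_lt_card (Finset.ssubset_univ_iff.mpr fun e => by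
      have : i ∈ better h i := e ▸ Finset.mem_univ i
      exact lt_irrefl _ (mem_better.mp this))
  simpa using this

/-- The better of the present champion `i` and the challenger `j`. -/
noncomputable def champion {n : ℕ} (h : Fin n → ℝ) (i j : Fin n) : Fin n :=
  if h i < h j then j else i

theorem le_champion {n : ℕ} (h : Fin n → ℝ) (i j : Fin n) : h i ≤ h (champion h i j) := by
  unfold champion
  split_ifs with hij
  exacts [hij.le, le_rfl]

/-- The probability that the search with the Grover iteration counts `ks`, started from the
champion `i`, ends with an element of maximal value. -/
noncomputable def chainProb {n : ℕ} (h : Fin n → ℝ) : List ℕ → Fin n → ℝ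
  | [], i => if better h i = ∅ then 1 else 0
  | k :: ks, i => ∑ j, groverAmp (better h i) k j ^ 2 * chainProb h ks (champion h i j)

/-- The elements beaten by fewer than `n / M` others. -/
noncomputable def topSet {n : ℕ} (h : Fin n → ℝ) (M : ℕ) : Finset (Fin n) :=
  Finset.univ.filter fun i => (better h i).card * M < n

theorem mem_topSet {n : ℕ} {h : Fin n → ℝ} {M : ℕ} {i : Fin n} :
    i ∈ topSet h M ↔ (better h i).card * M < n := by
  simp [topSet]

theorem mem_topSet_of_le {n : ℕ} {h : Fin n → ℝ} {M : ℕ} {i j : Fin n} (hij : h i ≤ h j)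
    (hi : i ∈ topSet h M) : j ∈ topSet h M := by
  rw [mem_topSet] at *
  exact (Nat.mul_le_mul_right M (Finset.card_le_card (better_subset hij))).trans_lt hi

/-- Take a best element outside the top set: everything that beats it is inside, and being outside
means that at least `n / M` elements beat it. Ties in `h` do no harm. -/
theorem le_card_topSet_mul {n : ℕ} (h : Fin n → ℝ) {M : ℕ} (hM : 1 ≤ M) :
    n ≤ (topSet h M).card * M := by
  by_cases hU : topSet h M = Finset.univ
  · rw [hU]
    simpa using Nat.le_mul_of_pos_right n hM
  · have hne : (topSet h M)ᶜ.Nonempty := by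
      rw [Finset.nonempty_iff_ne_empty, Ne, Finset.compl_eq_empty_iff]
      exact hU
    obtain ⟨i, hi, hmax⟩ := (topSet h M)ᶜ.exists_max_image h hne
    have hsub : better h i ⊆ topSet h M := by
      intro j hj
      by_contra hjn
      exact absurd (mem_better.mp hj) (not_lt.mpr (hmax j (Finset.mem_compl.mpr hjn)))
    have h1 : n ≤ (better h i).card * M := by
      by_contra hlt
      exact Finset.mem_compl.mp hi (mem_topSet.mpr (not_le.mp hlt))
    exact h1.trans (Nat.mul_le_mul_right M (Finset.card_le_card hsub))

/-- Since `i` lies outside the smaller top set, all of that set is marked. It has at least `n / (9 *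
M)` elements, each of weight at least `4 / π ^ 2 * (M / n)`; the product is the constant. -/
theorem le_sum_groverAmp_sq_topSet {n : ℕ} (h : Fin n → ℝ) {i : Fin n} {k M : ℕ}
    (hM : (2 * k + 1) ^ 2 = M) (hi : i ∈ topSet h M) (hi' : i ∉ topSet h (9 * M)) :
    4 / (9 * Real.pi ^ 2) ≤
      ∑ j ∈ topSet h (9 * M), groverAmp (better h i) k j ^ 2 := by
  have hn : (0 : ℝ) < n := by exact_mod_cast i.pos
  have hM1 : 1 ≤ M := hM ▸ Nat.one_le_pow _ _ (by omega)
  have hsub : ∀ j ∈ topSet h (9 * M), j ∈ better h i := by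
    intro j hj
    rw [mem_better]
    by_contra hlt
    exact hi' (mem_topSet_of_le (not_lt.mp hlt) hj)
  have hcard : (n : ℝ) ≤ (topSet h (9 * M)).card * (9 * M) := by
    exact_mod_cast le_card_topSet_mul h (by omega : 1 ≤ 9 * M)
  have hM' : ((2 * k + 1 : ℝ)) ^ 2 = M := by exact_mod_cast hM
  have hk : (2 * k + 1) ^ 2 * (better h i).card ≤ n := by
    rw [hM, mul_comm]
    exact (mem_topSet.mp hi).le
  refine le_trans ?_ (Finset.sum_le_sum fun j hj =>
    le_groverAmp_sq (card_better_lt h i) hk (hsub j hj))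
  rw [Finset.sum_const, nsmul_eq_mul, hM']
  have : 1 ≤ ((topSet h (9 * M)).card * (9 * M)) / (n : ℝ) := (one_le_div hn).mpr hcard
  calc 4 / (9 * Real.pi ^ 2) = 4 / (9 * Real.pi ^ 2) * 1 := (mul_one _).symm
    _ ≤ 4 / (9 * Real.pi ^ 2) * (((topSet h (9 * M)).card * (9 * M)) / (n : ℝ)) :=
        mul_le_mul_of_nonneg_left this (by positivity)
    _ = _ := by ring

/-- The champion never gets worse and the transition weights sum to one, so a superfluous round,
even one that overshoots, cannot spoil a bound valid for all better champions. -/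
theorem le_chainProb_cons {n : ℕ} {h : Fin n → ℝ} {ks : List ℕ} {k : ℕ} {i : Fin n} {v : ℝ}
    (hv : ∀ j, h i ≤ h j → v ≤ chainProb h ks j) : v ≤ chainProb h (k :: ks) i := by
  rw [chainProb]
  calc v = ∑ j, groverAmp (better h i) k j ^ 2 * v := by
        rw [← Finset.sum_mul, sum_sq_groverAmp i.pos, one_mul]
    _ ≤ _ := Finset.sum_le_sum fun j _ =>
        mul_le_mul_of_nonneg_left (hv _ (le_champion h i j)) (sq_nonneg _)

theorem chainProb_nonneg {n : ℕ} (h : Fin n → ℝ) (ks : List ℕ) (i : Fin n) :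
    0 ≤ chainProb h ks i := by
  induction ks generalizing i with
  | nil => rw [chainProb]; split_ifs <;> norm_num
  | cons k ks ih => exact le_chainProb_cons fun j _ => ih j

theorem le_chainProb_replicate {n : ℕ} {h : Fin n → ℝ} {ks : List ℕ} {k M : ℕ} {v : ℝ}
    (hv : ∀ i ∈ topSet h M, v ≤ chainProb h ks i) (R : ℕ) :
    ∀ i ∈ topSet h M, v ≤ chainProb h (List.replicate R k ++ ks) i := by
  induction R with
  | zero => simpa using hv
  | succ R ih =>
    intro i hi
    rw [List.replicate_succ, List.cons_append]
    exact le_chainProb_cons fun j hj => ih j (mem_topSet_of_le hj hi)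

/-- Each of `R` runs moves the champion from one top set to the next with constant probability. -/
theorem le_chainProb_phase {n : ℕ} {h : Fin n → ℝ} {ks : List ℕ} {k M : ℕ} {v : ℝ} (hv0 : 0 ≤ v)
    (hM : (2 * k + 1) ^ 2 = M) (hv : ∀ i ∈ topSet h (9 * M), v ≤ chainProb h ks i) (R : ℕ) :
    ∀ i ∈ topSet h M, (1 - (1 - 4 / (9 * Real.pi ^ 2)) ^ R) * v ≤
      chainProb h (List.replicate R k ++ ks) i := by
  have hπ : (3 : ℝ) < Real.pi := Real.pi_gt_three
  set c : ℝ := 4 / (9 * Real.pi ^ 2) with hc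
  have hc0 : 0 < c := by positivity
  have hc1 : c ≤ 1 := by
    rw [hc, div_le_one (by positivity)]
    nlinarith
  have hq : ∀ R : ℕ, 0 ≤ (1 - c) ^ R ∧ (1 - c) ^ R ≤ 1 := fun R =>
    ⟨pow_nonneg (by linarith) R, pow_le_one₀ (by linarith) (by linarith)⟩
  induction R with
  | zero =>
    intro i _
    simpa using chainProb_nonneg h ks i
  | succ R ih =>
    intro i hi
    by_cases hi' : i ∈ topSet h (9 * M)
    · refine le_trans ?_ (le_chainProb_replicate hv (R + 1) i hi')
      exact mul_le_of_le_one_left hv0 (by linarith [(hq (R + 1)).1])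
    · have hgood := le_sum_groverAmp_sq_topSet h hM hi hi'
      set w := (1 - (1 - c) ^ R) * v with hw
      have hwv : w ≤ v := mul_le_of_le_one_left hv0 (by linarith [(hq R).1])
      rw [List.replicate_succ, List.cons_append, chainProb]
      -- Every challenger leaves at least the inductive value `w`; one that lands in the next top
      -- set improves it to `v`. The resulting recursion `w ↦ w + c * (v - w)` is solved by `(1 - (1
      -- - c) ^ R) * v`.
      have hterm : ∀ j, groverAmp (better h i) k j ^ 2 * w +
          (if j ∈ topSet h (9 * M) then groverAmp (better h i) k j ^ 2 * (v - w) else 0) ≤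
          groverAmp (better h i) k j ^ 2 *
            chainProb h (List.replicate R k ++ ks) (champion h i j) := by
        intro j
        split_ifs with hj
        · have hlt : h i < h j := by
            by_contra hlt
            exact hi' (mem_topSet_of_le (not_lt.mp hlt) hj)
          have : v ≤ chainProb h (List.replicate R k ++ ks) (champion h i j) := by
            rw [champion, if_pos hlt]
            exact le_chainProb_replicate hv R j hj
          nlinarith [sq_nonneg (groverAmp (better h i) k j)]
        · rw [add_zero]
          exact mul_le_mul_of_nonneg_left
            (ih _ (mem_topSet_of_le (le_champion h i j) hi)) (sq_nonneg _)
      refine le_trans ?_ (Finset.sum_le_sum fun j _ => hterm j)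
      rw [Finset.sum_add_distrib, Finset.sum_ite_mem, Finset.univ_inter, ← Finset.sum_mul,
        ← Finset.sum_mul, sum_sq_groverAmp i.pos, one_mul]
      have h1 : c * (v - w) ≤
          (∑ j ∈ topSet h (9 * M), groverAmp (better h i) k j ^ 2) * (v - w) :=
        mul_le_mul_of_nonneg_right hgood (by linarith)
      have h2 : (1 - (1 - c) ^ (R + 1)) * v = w + c * (v - w) := by
        rw [hw, pow_succ]; ring
      linarith

/-- The Grover iteration counts of the last `j` phases, the first of them with `(3 ^ l - 1) / 2`
iterations; the phase with `j` phases remaining is repeated `j * M` times. -/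
def schedule (M : ℕ) : ℕ → ℕ → List ℕ
  | 0, _ => []
  | j + 1, l => List.replicate ((j + 1) * M) ((3 ^ l - 1) / 2) ++ schedule M j (l + 1)

theorem two_mul_phase_add_one (l : ℕ) : 2 * ((3 ^ l - 1) / 2) + 1 = 3 ^ l := by
  have h : Odd (3 ^ l) := (by decide : Odd 3).pow
  obtain ⟨a, ha⟩ := h
  omega

/-- The closed form equals `1` at `j = 0` and absorbs a factor `1 - q ^ (j + 1)` per phase because
`q ≤ 1 / 2`. When no phase remains, `n ≤ 9 ^ l` leaves only maximal elements in the top set. -/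
theorem le_chainProb_schedule {n : ℕ} {h : Fin n → ℝ} {M : ℕ} {q : ℝ}
    (hq : (1 - 4 / (9 * Real.pi ^ 2)) ^ M = q) (hq0 : 0 ≤ q) (hq1 : q ≤ 1 / 2) (j l : ℕ)
    (hl : n ≤ 9 ^ (l + j)) :
    ∀ i ∈ topSet h (9 ^ l), 1 - 2 * q + 2 * q ^ (j + 1) ≤ chainProb h (schedule M j l) i := by
  induction j generalizing l with
  | zero =>
    intro i hi
    have : better h i = ∅ := by
      rw [← Finset.card_eq_zero]
      by_contra h0
      have := mem_topSet.mp hi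
      have h1 : 1 * 9 ^ l ≤ (better h i).card * 9 ^ l :=
        Nat.mul_le_mul_right _ (Nat.one_le_iff_ne_zero.mpr h0)
      rw [add_zero] at hl
      omega
    simp [schedule, chainProb, this]
  | succ j ih =>
    intro i hi
    have hph : (2 * ((3 ^ l - 1) / 2) + 1) ^ 2 = 9 ^ l := by
      rw [two_mul_phase_add_one, ← pow_mul, mul_comm, pow_mul]
      norm_num
    have h9 : 9 * 9 ^ l = 9 ^ (l + 1) := (pow_succ' 9 l).symm
    have hrec := ih (l + 1) (by rwa [add_assoc, add_comm 1])
    rw [← h9] at hrec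
    have hp : 0 ≤ q ^ (j + 1) := pow_nonneg hq0 _
    have hmain := le_chainProb_phase (by linarith : 0 ≤ 1 - 2 * q + 2 * q ^ (j + 1)) hph hrec
      ((j + 1) * M) i hi
    rw [mul_comm (j + 1) M, pow_mul, hq, mul_comm M] at hmain
    refine le_trans ?_ hmain
    have e1 : q ^ (j + 1 + 1) = q * q ^ (j + 1) := pow_succ' q (j + 1)
    rw [e1]
    have hqj : q ^ (j + 1) ≤ q := by
      simpa using pow_le_pow_of_le_one hq0 (by linarith) (by omega : 1 ≤ j + 1)
    nlinarith [mul_nonneg hp hq0, mul_nonneg hp (sub_nonneg.mpr hqj)]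

/-- Keeping the subtracted linear term makes the arithmetic-geometric sum an exact identity,
provable by induction; dropping it later gives the cost bound. -/
theorem sum_schedule (M j l : ℕ) :
    4 * ((schedule M j l).map fun k => 2 * k + 1).sum + M * 3 ^ l * (2 * j + 3) =
      M * 3 ^ l * 3 ^ (j + 1) := by
  induction j generalizing l with
  | zero => simp [schedule]
  | succ j ih =>
    have := ih (l + 1)
    simp only [schedule, List.map_append, List.map_replicate, List.sum_append,
      List.sum_replicate, two_mul_phase_add_one, smul_eq_mul]
    rw [pow_succ] at this
    rw [pow_succ 3 (j + 1)]
    linarith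

end Chain

/-! ## Superpositions of basis states -/

section States

variable {B ι : Type}

theorem basisState_apply_self (b : B) : basisState b b = 1 := by
  simp [basisState]

theorem basisState_apply_of_ne {b b' : B} (h : b' ≠ b) : basisState b b' = 0 := by
  simp [basisState, h]

theorem norm_basisState (b : B) : ‖basisState b‖ = 1 := by
  simp [basisState, lp.norm_single]

theorem inner_basisState_left (b : B) (ψ : QState B) : inner ℂ (basisState b) ψ = ψ b := by
  simp [basisState, lp.inner_single_left]

theorem permUnitary_basisState (e : Equiv.Perm B) (b : B) :
    permUnitary e (basisState b) = basisState (e b) := by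
  ext b'
  change basisState b (e.symm b') = basisState (e b) b'
  by_cases h : b' = e b
  · rw [h, Equiv.symm_apply_apply, basisState_apply_self, basisState_apply_self]
  · rw [basisState_apply_of_ne h, basisState_apply_of_ne fun h' => h (by simp [← h'])]

open Classical in
/-- The state with the signs of the amplitudes in `G` flipped. -/
noncomputable def flipState (G : Set B) (ψ : QState B) : QState B :=
  ⟨fun b => if b ∈ G then -ψ b else ψ b,
    QState.memlp_of_le ψ _ fun b => by split_ifs <;> simp⟩

open Classical in
theorem flipState_apply (G : Set B) (ψ : QState B) (b : B) :
    flipState G ψ b = if b ∈ G then -ψ b else ψ b := rfl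

theorem flipState_flipState (G : Set B) (ψ : QState B) : flipState G (flipState G ψ) = ψ := by
  refine lp.ext (funext fun b => ?_)
  rw [flipState_apply, flipState_apply]
  split_ifs <;> simp

/-- The unitary that flips the sign of the basis states with labels in `G`. -/
noncomputable def signFlip (G : Set B) : QState B ≃ₗᵢ[ℂ] QState B where
  toFun := flipState G
  invFun := flipState G
  map_add' ψ φ := by
    refine lp.ext (funext fun b => ?_)
    rw [lp.coeFn_add, Pi.add_apply, flipState_apply, flipState_apply, flipState_apply,
      lp.coeFn_add, Pi.add_apply]
    split_ifs
    · rw [neg_add]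
    · rfl
  map_smul' a ψ := by
    refine lp.ext (funext fun b => ?_)
    rw [RingHom.id_apply, lp.coeFn_smul, Pi.smul_apply, flipState_apply, flipState_apply,
      lp.coeFn_smul, Pi.smul_apply]
    split_ifs
    · rw [smul_neg]
    · rfl
  left_inv := flipState_flipState G
  right_inv := flipState_flipState G
  norm_map' ψ := by
    have h2 : (0 : ℝ) < (2 : ℝ≥0∞).toReal := by norm_num
    change ‖flipState G ψ‖ = ‖ψ‖
    rw [lp.norm_eq_tsum_rpow h2, lp.norm_eq_tsum_rpow h2]
    congr 1
    refine tsum_congr fun b => ?_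
    rw [flipState_apply]
    split_ifs
    · rw [norm_neg]
    · rfl

open Classical in
theorem signFlip_basisState (G : Set B) (b : B) :
    signFlip G (basisState b) = (if b ∈ G then (-1 : ℂ) else 1) • basisState b := by
  ext b'
  change (if b' ∈ G then -basisState b b' else basisState b b') =
    (if b ∈ G then (-1 : ℂ) else 1) * basisState b b'
  by_cases h : b' = b
  · rw [h]
    split_ifs <;> simp
  · rw [basisState_apply_of_ne h]
    simp

/-- The superposition of the basis states `lab i` with real amplitudes `c i`. -/
noncomputable def superpos [Fintype ι] (lab : ι → B) (c : ι → ℝ) : QState B :=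
  ∑ i, (c i : ℂ) • basisState (lab i)

variable [Fintype ι]

theorem permUnitary_superpos (e : Equiv.Perm B) (lab : ι → B) (c : ι → ℝ) :
    permUnitary e (superpos lab c) = superpos (fun i => e (lab i)) c := by
  simp only [superpos, map_sum, map_smul, permUnitary_basisState]

open Classical in
theorem signFlip_superpos (G : Set B) (lab : ι → B) (c : ι → ℝ) :
    signFlip G (superpos lab c) = superpos lab fun i => if lab i ∈ G then -c i else c i := by
  simp only [superpos, map_sum, map_smul, signFlip_basisState, smul_smul]
  refine Finset.sum_congr rfl fun i _ => ?_
  split_ifs <;> simp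

theorem superpos_apply_of_not_mem {lab : ι → B} {b : B} (hb : ∀ i, lab i ≠ b) (c : ι → ℝ) :
    superpos lab c b = 0 := by
  rw [← inner_basisState_left, superpos, inner_sum]
  refine Finset.sum_eq_zero fun i _ => ?_
  rw [inner_smul_right, inner_basisState_left, basisState_apply_of_ne (hb i).symm, mul_zero]

theorem superpos_apply {lab : ι → B} (hlab : Function.Injective lab) (c : ι → ℝ) (i : ι) :
    superpos lab c (lab i) = c i := by
  rw [← inner_basisState_left, superpos, inner_sum, Finset.sum_eq_single i]
  · rw [inner_smul_right, inner_basisState_left, basisState_apply_self, mul_one]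
  · intro j _ hj
    rw [inner_smul_right, inner_basisState_left,
      basisState_apply_of_ne fun h => hj (hlab h).symm, mul_zero]
  · simp

theorem inner_superpos {lab : ι → B} (hlab : Function.Injective lab) (c c' : ι → ℝ) :
    inner ℂ (superpos lab c) (superpos lab c') = ((∑ i, c i * c' i : ℝ) : ℂ) := by
  rw [superpos, sum_inner]
  push_cast
  refine Finset.sum_congr rfl fun i _ => ?_
  rw [inner_smul_left, inner_basisState_left, superpos_apply hlab]
  simp

theorem norm_superpos_sq {lab : ι → B} (hlab : Function.Injective lab) (c : ι → ℝ) :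
    ‖superpos lab c‖ ^ 2 = ∑ i, c i ^ 2 := by
  rw [← inner_self_eq_norm_sq (𝕜 := ℂ), inner_superpos hlab]
  change (((∑ i, c i * c i : ℝ) : ℂ)).re = _
  rw [Complex.ofReal_re]
  exact Finset.sum_congr rfl fun i _ => (sq (c i)).symm

/-- Grover's diffusion operator: the reflection in the uniform superposition. -/
noncomputable def diffusion (lab : ι → B) : QState B ≃ₗᵢ[ℂ] QState B :=
  (ℂ ∙ superpos lab fun _ => 1).reflection

theorem diffusion_superpos {lab : ι → B} (hlab : Function.Injective lab) (c : ι → ℝ) :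
    diffusion lab (superpos lab c) =
      superpos lab fun i => 2 * ((∑ j, c j) / Fintype.card ι) - c i := by
  have h2 : ((‖superpos lab fun _ => (1 : ℝ)‖ : ℂ)) ^ 2 = Fintype.card ι := by
    rw [← Complex.ofReal_pow, norm_superpos_sq hlab]
    simp
  rw [diffusion, Submodule.reflection_singleton_apply, inner_superpos hlab]
  change 2 • (_ / ((‖superpos lab fun _ => (1 : ℝ)‖ : ℂ)) ^ 2) • _ - _ = _
  rw [h2]
  simp only [superpos, Finset.smul_sum, ← Finset.sum_sub_distrib]
  refine Finset.sum_congr rfl fun i _ => ?_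
  rw [smul_smul, ← Nat.cast_smul_eq_nsmul ℂ, smul_smul, ← sub_smul]
  push_cast
  simp

/-- The reflection in `u + v` takes the unit vector `u` to the unit vector `v`. -/
theorem reflection_add_apply {E : Type*} [NormedAddCommGroup E] [InnerProductSpace ℂ E] {u v : E}
    (hu : ‖u‖ = 1) (hv : ‖v‖ = 1) {r : ℝ} (hr : 0 ≤ r) (huv : inner ℂ u v = r) :
    (ℂ ∙ (u + v)).reflection u = v := by
  have hvu : inner ℂ v u = (r : ℂ) := by
    rw [← inner_conj_symm, huv, Complex.conj_ofReal]
  have huu : inner ℂ u u = (1 : ℂ) := by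
    rw [inner_self_eq_norm_sq_to_K, hu]; simp
  have hvv : inner ℂ v v = (1 : ℂ) := by
    rw [inner_self_eq_norm_sq_to_K, hv]; simp
  have h1 : inner ℂ (u + v) u = (1 + r : ℂ) := by rw [inner_add_left, huu, hvu]
  have h2 : ((‖u + v‖ : ℂ)) ^ 2 = 2 * (1 + r) := by
    have := inner_self_eq_norm_sq_to_K (𝕜 := ℂ) (u + v)
    rw [inner_add_left, inner_add_right, inner_add_right, huu, hvv, huv, hvu] at this
    exact this.symm.trans (by ring)
  have h3 : (1 + r : ℂ) ≠ 0 := by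
    exact_mod_cast (by linarith : (0 : ℝ) < 1 + r).ne'
  rw [Submodule.reflection_singleton_apply, h1]
  change 2 • ((1 + r : ℂ) / ((‖u + v‖ : ℂ)) ^ 2) • (u + v) - u = v
  rw [h2, ← Nat.cast_smul_eq_nsmul ℂ, smul_smul]
  have h4 : ((2 : ℕ) : ℂ) * ((1 + r : ℂ) / (2 * (1 + r))) = 1 := by
    push_cast
    field_simp
  rw [h4, one_smul, add_sub_cancel_left]

/-- A unitary that takes the basis state `b` to the uniform superposition. -/
noncomputable def prepare (lab : ι → B) (b : B) : QState B ≃ₗᵢ[ℂ] QState B :=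
  (ℂ ∙ (basisState b + superpos lab fun _ => 1 / √(Fintype.card ι))).reflection

theorem prepare_basisState [Nonempty ι] {lab : ι → B} (hlab : Function.Injective lab) (b : B) :
    prepare lab b (basisState b) = superpos lab fun _ => 1 / √(Fintype.card ι) := by
  have hn : (0 : ℝ) < Fintype.card ι := by exact_mod_cast Fintype.card_pos
  have hv : ‖superpos lab fun _ => 1 / √(Fintype.card ι)‖ = 1 := by
    have := norm_superpos_sq hlab fun _ => 1 / √(Fintype.card ι)
    rw [← sq_eq_sq₀ (norm_nonneg _) zero_le_one, this]
    simp [hn.ne']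
  -- The overlap of `b` with the uniform superposition is `1 / √n` or `0`; in both cases it is real
  -- and nonnegative, as the reflection requires.
  by_cases hb : ∃ i, lab i = b
  · obtain ⟨i, rfl⟩ := hb
    refine reflection_add_apply (norm_basisState _) hv (r := 1 / √(Fintype.card ι)) (by positivity)
      ?_
    rw [inner_basisState_left, superpos_apply hlab]
  · push Not at hb
    refine reflection_add_apply (norm_basisState _) hv le_rfl ?_
    rw [inner_basisState_left, superpos_apply_of_not_mem hb, Complex.ofReal_zero]

end States

/-! ## Measuring all registers -/

section Measurement

variable {d : ℕ} {W R : Type}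

theorem collapse_smul {B α : Type} (m : B → α) (a : α) (c : ℂ) (ψ : QState B) :
    collapse m a (c • ψ) = c • collapse m a ψ := by
  ext b
  simp only [collapse, lp.coeFn_smul, Pi.smul_apply]
  split_ifs <;> simp

theorem collapse_id {B : Type} (b : B) (ψ : QState B) :
    collapse id b ψ = ψ b • basisState b := by
  ext b'
  simp only [collapse, lp.coeFn_smul, Pi.smul_apply, id]
  by_cases h : b' = b
  · rw [h, basisState_apply_self]
    simp
  · rw [basisState_apply_of_ne h]
    simp [h]

/-- Collapsed states are not normalised; homogeneity of degree two turns their scalar factors into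
classical branch probabilities. -/
theorem QProgram.prob_smul (f : EuclideanSpace ℝ (Fin d) → ℝ) (S : Set R) (P : QProgram d W R)
    (c : ℂ) (ψ : QState (Registers d W)) : P.prob f S (c • ψ) = ‖c‖ₑ ^ 2 * P.prob f S ψ := by
  induction P generalizing ψ with
  | done out =>
    simp only [QProgram.prob, ← ENNReal.tsum_mul_left]
    refine tsum_congr fun b => ?_
    split_ifs
    · simp [enorm_mul, mul_pow]
    · simp
  | unitary U next ih => simp only [QProgram.prob, map_smul, ih]
  | query next ih => simp only [QProgram.prob, map_smul, ih]
  | measure m next ih => simp only [QProgram.prob, collapse_smul, ih, ENNReal.tsum_mul_left]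

theorem QProgram.prob_measure_superpos {ι : Type} [Fintype ι]
    (f : EuclideanSpace ℝ (Fin d) → ℝ) (S : Set R) (next : Registers d W → QProgram d W R)
    {lab : ι → Registers d W} (hlab : Function.Injective lab) (c : ι → ℝ) :
    (QProgram.measure id next).prob f S (superpos lab c) =
      ∑ i, ENNReal.ofReal (c i ^ 2) * (next (lab i)).prob f S (basisState (lab i)) := by
  classical
  simp only [QProgram.prob, collapse_id, QProgram.prob_smul]
  rw [tsum_eq_sum (s := Finset.univ.map ⟨lab, hlab⟩), Finset.sum_map]
  · refine Finset.sum_congr rfl fun i _ => ?_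
    simp only [Function.Embedding.coeFn_mk, superpos_apply hlab]
    rw [← sq_abs, ENNReal.ofReal_pow (abs_nonneg _), ← Real.enorm_eq_ofReal_abs]
    congr 2
    simp [enorm_eq_nnnorm]
  · intro b hb
    rw [superpos_apply_of_not_mem]
    · simp
    · intro i h
      exact hb (by simp [← h])

end Measurement

/-! ## Maximum finding with a function-value oracle -/

section Search

variable {d n : ℕ} {R : Type}

/-- Work registers: an index and a list of slots for function values. -/
abbrev SearchWork (n : ℕ) : Type := Fin n × (ℕ → ℝ)

/-- Translate the query register to the `k`-th query point of the current index. -/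
def loadPerm (sh : Fin n → ℕ → EuclideanSpace ℝ (Fin d)) (k : ℕ) :
    Equiv.Perm (Registers d (SearchWork n)) where
  toFun b := (b.1 + sh b.2.2.1 k, b.2)
  invFun b := (b.1 - sh b.2.2.1 k, b.2)
  left_inv b := by simp
  right_inv b := by simp

/-- Swap the answer register with slot `k`, and translate the query register back. -/
def storePerm (sh : Fin n → ℕ → EuclideanSpace ℝ (Fin d)) (k : ℕ) :
    Equiv.Perm (Registers d (SearchWork n)) where
  toFun b := (b.1 - sh b.2.2.1 k, b.2.2.2 k, b.2.2.1, Function.update b.2.2.2 k b.2.1)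
  invFun b := (b.1 + sh b.2.2.1 k, b.2.2.2 k, b.2.2.1, Function.update b.2.2.2 k b.2.1)
  left_inv b := by simp
  right_inv b := by simp

/-- Negate the answer register. -/
def negPerm (d : ℕ) (W : Type) : Equiv.Perm (Registers d W) where
  toFun b := (b.1, -b.2.1, b.2.2)
  invFun b := (b.1, -b.2.1, b.2.2)
  left_inv b := by simp
  right_inv b := by simp

/-- Query the first `m` query points of the current index and store the values in the slots. -/
noncomputable def compute (sh : Fin n → ℕ → EuclideanSpace ℝ (Fin d)) :
    ℕ → QProgram d (SearchWork n) R → QProgram d (SearchWork n) R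
  | 0, P => P
  | m + 1, P => .unitary (permUnitary (loadPerm sh m))
      (.query (.unitary (permUnitary (storePerm sh m)) (compute sh m P)))

/-- Undo `compute`. -/
noncomputable def uncompute (sh : Fin n → ℕ → EuclideanSpace ℝ (Fin d)) :
    ℕ → QProgram d (SearchWork n) R → QProgram d (SearchWork n) R
  | 0, P => P
  | m + 1, P => uncompute sh m (.unitary (permUnitary (storePerm sh m).symm)
      (.unitary (permUnitary (negPerm d (SearchWork n))) (.query
        (.unitary (permUnitary (negPerm d (SearchWork n)))
          (.unitary (permUnitary (loadPerm sh m).symm) P)))))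

/-- The permutation of the labels that is effected by `compute`. -/
def computePerm (sh : Fin n → ℕ → EuclideanSpace ℝ (Fin d))
    (f : EuclideanSpace ℝ (Fin d) → ℝ) : ℕ → Equiv.Perm (Registers d (SearchWork n))
  | 0 => Equiv.refl _
  | m + 1 => (((loadPerm sh m).trans (oraclePerm (SearchWork n) f)).trans
      (storePerm sh m)).trans (computePerm sh f m)

variable (sh : Fin n → ℕ → EuclideanSpace ℝ (Fin d)) (f : EuclideanSpace ℝ (Fin d) → ℝ)
  (S : Set R)

theorem prob_compute (m : ℕ) (P : QProgram d (SearchWork n) R)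
    (ψ : QState (Registers d (SearchWork n))) :
    (compute sh m P).prob f S ψ = P.prob f S (permUnitary (computePerm sh f m) ψ) := by
  induction m generalizing ψ with
  | zero => rfl
  | succ m ih =>
    simp only [compute, QProgram.prob]
    rw [ih]
    rfl

/-- Programs may call only the forward oracle; conjugation by negation of the answer register
supplies its inverse at the cost of one call. -/
theorem oraclePerm_symm_eq (W : Type) :
    (oraclePerm W f).symm = ((negPerm d W).trans (oraclePerm W f)).trans (negPerm d W) := by
  ext b <;> simp [oraclePerm, negPerm]; ring

theorem prob_uncompute (m : ℕ) (P : QProgram d (SearchWork n) R)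
    (ψ : QState (Registers d (SearchWork n))) :
    (uncompute sh m P).prob f S ψ = P.prob f S (permUnitary (computePerm sh f m).symm ψ) := by
  induction m generalizing P ψ with
  | zero => rfl
  | succ m ih =>
    rw [uncompute, ih]
    simp only [QProgram.prob]
    have h : (computePerm sh f (m + 1)).symm = (((((computePerm sh f m).symm.trans
        (storePerm sh m).symm).trans (negPerm d (SearchWork n))).trans
        (oraclePerm (SearchWork n) f)).trans (negPerm d (SearchWork n))).trans
        (loadPerm sh m).symm := by
      ext1 b
      simp only [computePerm, Equiv.symm_trans_apply, oraclePerm_symm_eq, Equiv.trans_apply]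
    rw [h]
    rfl

theorem queries_compute (m : ℕ) (P : QProgram d (SearchWork n) R) :
    (compute sh m P).queries = P.queries + m := by
  induction m with
  | zero => simp [compute]
  | succ m ih =>
    simp only [compute, QProgram.queries, ih]
    push_cast
    rw [add_assoc]

theorem queries_uncompute (m : ℕ) (P : QProgram d (SearchWork n) R) :
    (uncompute sh m P).queries = P.queries + m := by
  induction m generalizing P with
  | zero => simp [uncompute]
  | succ m ih =>
    simp only [uncompute, QProgram.queries, ih]
    push_cast
    rw [add_assoc, add_comm 1]

/-- The label with index `i` and empty slots. -/
def blankLabel (x : EuclideanSpace ℝ (Fin d)) (i : Fin n) : Registers d (SearchWork n) :=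
  (x, 0, i, 0)

/-- The label with index `i` and the values of `f` at the first `m` query points. -/
def filledLabel (m : ℕ) (x : EuclideanSpace ℝ (Fin d)) (i : Fin n) :
    Registers d (SearchWork n) :=
  (x, 0, i, fun k => if k < m then f (x + sh i k) else 0)

theorem blankLabel_injective (x : EuclideanSpace ℝ (Fin d)) :
    Function.Injective (blankLabel (n := n) x) := fun _ _ h =>
  congrArg (fun b : Registers d (SearchWork n) => b.2.2.1) h

theorem filledLabel_injective (m : ℕ) (x : EuclideanSpace ℝ (Fin d)) :
    Function.Injective (filledLabel sh f m x) := fun _ _ h =>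
  congrArg (fun b : Registers d (SearchWork n) => b.2.2.1) h

/-- Swapping with an empty slot resets the answer register to `0` for the next query. Slots are
filled from the top down, so the induction must allow arbitrary content above `m`. -/
theorem computePerm_apply (m : ℕ) (x : EuclideanSpace ℝ (Fin d)) (i : Fin n) (v : ℕ → ℝ)
    (hv : ∀ k < m, v k = 0) : computePerm sh f m (x, 0, i, v) =
      (x, 0, i, fun k => if k < m then f (x + sh i k) else v k) := by
  induction m generalizing v with
  | zero => simp [computePerm]
  | succ m ih =>
    have h1 : computePerm sh f (m + 1) (x, 0, i, v) =
        computePerm sh f m (x, 0, i, Function.update v m (f (x + sh i m))) := by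
      simp [computePerm, loadPerm, storePerm, oraclePerm, hv m (Nat.lt_succ_self m)]
    rw [h1, ih _ fun k hk => by
      rw [Function.update_of_ne hk.ne]; exact hv k (hk.trans (Nat.lt_succ_self m))]
    refine Prod.ext rfl (Prod.ext rfl (Prod.ext rfl (funext fun k => ?_)))
    rcases lt_trichotomy k m with h | rfl | h
    · simp [h, h.trans (Nat.lt_succ_self m)]
    · simp
    · have h' : ¬ k < m + 1 := by omega
      simp only [h.not_gt, h', if_false, Function.update_of_ne h.ne']

theorem computePerm_blankLabel (m : ℕ) (x : EuclideanSpace ℝ (Fin d)) (i : Fin n) :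
    computePerm sh f m (blankLabel x i) = filledLabel sh f m x i :=
  computePerm_apply sh f m x i 0 fun _ _ => rfl

/-- One Grover iteration at the point `x`, with the marked labels `G`. -/
noncomputable def groverIter (m : ℕ) (x : EuclideanSpace ℝ (Fin d))
    (G : Set (Registers d (SearchWork n))) (P : QProgram d (SearchWork n) R) :
    QProgram d (SearchWork n) R :=
  compute sh m (.unitary (signFlip G) (uncompute sh m (.unitary (diffusion (blankLabel x)) P)))

/-- Uncomputing the slots after the sign flip disentangles the index from the function values, so
that the diffusion acts on blank labels and the amplitudes interfere. -/
theorem prob_groverIter (m : ℕ) (x : EuclideanSpace ℝ (Fin d))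
    {G : Set (Registers d (SearchWork n))} {H : Finset (Fin n)}
    (hGH : ∀ i, filledLabel sh f m x i ∈ G ↔ i ∈ H) (P : QProgram d (SearchWork n) R) (k : ℕ) :
    (groverIter sh m x G P).prob f S (superpos (blankLabel x) (groverAmp H k)) =
      P.prob f S (superpos (blankLabel x) (groverAmp H (k + 1))) := by
  rw [groverIter, prob_compute, QProgram.prob, prob_uncompute, QProgram.prob,
    permUnitary_superpos, signFlip_superpos, permUnitary_superpos]
  simp only [computePerm_blankLabel, hGH]
  have h : ∀ i, (computePerm sh f m).symm (filledLabel sh f m x i) = blankLabel x i := fun i => by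
    rw [← computePerm_blankLabel, Equiv.symm_apply_apply]
  simp only [h]
  rw [diffusion_superpos (blankLabel_injective x), Fintype.card_fin]
  congr 2

theorem prob_groverIter_iterate (m : ℕ) (x : EuclideanSpace ℝ (Fin d))
    {G : Set (Registers d (SearchWork n))} {H : Finset (Fin n)}
    (hGH : ∀ i, filledLabel sh f m x i ∈ G ↔ i ∈ H) (P : QProgram d (SearchWork n) R) (k l : ℕ) :
    ((groverIter sh m x G)^[k] P).prob f S (superpos (blankLabel x) (groverAmp H l)) =
      P.prob f S (superpos (blankLabel x) (groverAmp H (l + k))) := by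
  induction k generalizing l with
  | zero => rfl
  | succ k ih =>
    rw [Function.iterate_succ_apply', prob_groverIter sh f S m x hGH, ih, add_assoc, add_comm 1]

theorem queries_groverIter_iterate (m : ℕ) (x : EuclideanSpace ℝ (Fin d))
    (G : Set (Registers d (SearchWork n))) (P : QProgram d (SearchWork n) R) (k : ℕ) :
    ((groverIter sh m x G)^[k] P).queries = P.queries + ((2 * k * m : ℕ) : ℕ∞) := by
  induction k with
  | zero => simp
  | succ k ih =>
    rw [Function.iterate_succ_apply', groverIter, queries_compute, QProgram.queries,
      queries_uncompute, QProgram.queries, ih, add_assoc, add_assoc]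
    congr 1
    push_cast
    ring

variable (score : Registers d (SearchWork n) → ℝ) (out : Registers d (SearchWork n) → R)

/-- Maximum finding: for each entry `k` of the list, prepare the uniform superposition, make `k`
Grover iterations that mark what beats the champion, and measure a challenger. The arguments
`best` and `cur` are the labels of the champion and of the present basis state. -/
noncomputable def maxSearch (m : ℕ) : List ℕ → Registers d (SearchWork n) →
    Registers d (SearchWork n) → QProgram d (SearchWork n) R
  | [], best, _ => .done fun _ => out best
  | k :: ks, best, cur => .unitary (prepare (blankLabel cur.1) cur)
      ((groverIter sh m cur.1 {b | score best < score b})^[k]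
        (compute sh m (.measure id fun b =>
          maxSearch m ks (if score best < score b then b else best) b)))

theorem queries_maxSearch_le (m : ℕ) (ks : List ℕ) (best cur : Registers d (SearchWork n)) :
    (maxSearch sh score out m ks best cur).queries ≤
      ((m * (ks.map fun k => 2 * k + 1).sum : ℕ) : ℕ∞) := by
  induction ks generalizing best cur with
  | nil => simp [maxSearch, QProgram.queries]
  | cons k ks ih =>
    rw [maxSearch, QProgram.queries, queries_groverIter_iterate, queries_compute,
      QProgram.queries]
    refine (add_le_add_left (add_le_add_left (iSup_le fun b => ih _ b) _) _).trans (le_of_eq ?_)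
    rw [List.map_cons, List.sum_cons]
    norm_cast
    ring

/-- The champion `i` is classical memory, whereas the registers hold the last challenger `j`,
whether or not it won; the induction must decouple the two. -/
theorem le_prob_maxSearch (m : ℕ) (x : EuclideanSpace ℝ (Fin d))
    (hS : ∀ i, better (fun j => score (filledLabel sh f m x j)) i = ∅ →
      out (filledLabel sh f m x i) ∈ S) (ks : List ℕ) (i j : Fin n) :
    ENNReal.ofReal (chainProb (fun j => score (filledLabel sh f m x j)) ks i) ≤
      (maxSearch sh score out m ks (filledLabel sh f m x i) (filledLabel sh f m x j)).prob f S
        (basisState (filledLabel sh f m x j)) := by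
  have : Nonempty (Fin n) := ⟨i⟩
  induction ks generalizing i j with
  | nil =>
    rw [chainProb]
    split_ifs with h
    · simp only [maxSearch, QProgram.prob, hS i h, if_true]
      refine le_trans (le_of_eq ?_) (ENNReal.le_tsum (filledLabel sh f m x j))
      rw [basisState_apply_self]
      simp
    · simp
  | cons k ks ih =>
    set h : Fin n → ℝ := fun j => score (filledLabel sh f m x j) with hh
    have hGH : ∀ a, filledLabel sh f m x a ∈
        {b | score (filledLabel sh f m x i) < score b} ↔ a ∈ better h i := fun a => by
      rw [mem_better]
      rfl
    have hprep := prepare_basisState (blankLabel_injective x) (filledLabel sh f m x j)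
    rw [Fintype.card_fin] at hprep
    have hamp : (fun _ : Fin n => 1 / √(n : ℝ)) = groverAmp (better h i) 0 := by
      ext a
      rw [groverAmp]
    rw [hamp] at hprep
    rw [maxSearch, QProgram.prob]
    change _ ≤ ((groverIter sh m x _)^[k] _).prob f S
      (prepare (blankLabel x) (filledLabel sh f m x j) _)
    rw [hprep, prob_groverIter_iterate sh f S m x hGH, zero_add, prob_compute,
      permUnitary_superpos]
    simp only [computePerm_blankLabel]
    rw [QProgram.prob_measure_superpos f S _ (filledLabel_injective sh f m x), chainProb,
      ENNReal.ofReal_sum_of_nonneg fun a _ => mul_nonneg (sq_nonneg _) (chainProb_nonneg h ks _)]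
    refine Finset.sum_le_sum fun a _ => ?_
    rw [ENNReal.ofReal_mul (sq_nonneg _)]
    refine mul_le_mul_right ?_ _
    have e : (if score (filledLabel sh f m x i) < score (filledLabel sh f m x a)
        then filledLabel sh f m x a else filledLabel sh f m x i) =
        filledLabel sh f m x (champion h i a) := by
      simp only [champion, hh]
      split_ifs <;> rfl
    rw [e]
    exact ih _ a

/-- Maximum finding, started with the first index as champion. -/
noncomputable def maxSearchAlgorithm (hn : 0 < n) (m : ℕ) (ks : List ℕ) : QAlgorithm d R where
  Work := SearchWork n
  init := (⟨0, hn⟩, 0)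
  program := compute sh m (.measure id fun b => maxSearch sh score out m ks b b)

theorem queries_maxSearchAlgorithm_le (hn : 0 < n) (m : ℕ) (ks : List ℕ) :
    (maxSearchAlgorithm sh score out hn m ks).queries ≤
      ((m * ((ks.map fun k => 2 * k + 1).sum + 1) : ℕ) : ℕ∞) := by
  rw [QAlgorithm.queries, maxSearchAlgorithm, queries_compute, QProgram.queries]
  refine (add_le_add_left (iSup_le fun b => queries_maxSearch_le sh score out m ks b b) _).trans
    (le_of_eq ?_)
  norm_cast

/-- The initial state is a basis state, so the first measurement reveals `x` and the first score
without disturbance. Later unitaries may then depend on `x` through the outcome. -/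
theorem le_prob_maxSearchAlgorithm (hn : 0 < n) (m : ℕ) (ks : List ℕ)
    (x : EuclideanSpace ℝ (Fin d))
    (hS : ∀ i, (∀ j, score (filledLabel sh f m x j) ≤ score (filledLabel sh f m x i)) →
      out (filledLabel sh f m x i) ∈ S) :
    ENNReal.ofReal (chainProb (fun j => score (filledLabel sh f m x j)) ks ⟨0, hn⟩) ≤
      (maxSearchAlgorithm sh score out hn m ks).prob f x S := by
  have hS' : ∀ i, better (fun j => score (filledLabel sh f m x j)) i = ∅ →
      out (filledLabel sh f m x i) ∈ S := fun i hi => hS i fun j => by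
    by_contra hlt
    have : j ∈ better (fun j => score (filledLabel sh f m x j)) i :=
      mem_better.mpr (not_le.mp hlt)
    rw [hi] at this
    exact absurd this (Finset.notMem_empty j)
  refine (le_prob_maxSearch sh f S score out m x hS' ks ⟨0, hn⟩ ⟨0, hn⟩).trans (le_of_eq ?_)
  rw [QAlgorithm.prob, maxSearchAlgorithm, prob_compute, permUnitary_basisState]
  change _ = QProgram.prob f S _ (basisState (computePerm sh f m (blankLabel x ⟨0, hn⟩)))
  rw [computePerm_blankLabel]
  have hsup : basisState (filledLabel sh f m x ⟨0, hn⟩) =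
      superpos (fun _ : Unit => filledLabel sh f m x ⟨0, hn⟩) fun _ => 1 := by
    simp [superpos]
  nth_rewrite 2 [hsup]
  rw [QProgram.prob_measure_superpos f S _ (Function.injective_of_subsingleton _)]
  simp

end Search

/-! ### Choice of parameters and reduction of the linear subproblem to maximum finding -/

section FrankWolfe

/-- A list of Grover iteration counts of total length `O(√n log(1/δ))` that finds a maximum with
probability at least `1 - δ`. -/
theorem exists_schedule : ∃ C : ℝ, 0 < C ∧ ∀ n : ℕ, 0 < n → ∀ δ : ℝ, 0 < δ → δ ≤ 1 / 2 →
    ∃ ks : List ℕ, (((ks.map fun k => 2 * k + 1).sum + 1 : ℕ) : ℝ) ≤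
      C * (√n * Real.log (1 / δ)) ∧
      ∀ (h : Fin n → ℝ) (i : Fin n), 1 - δ ≤ chainProb h ks i := by
  have hπ : (3 : ℝ) < Real.pi := Real.pi_gt_three
  set c : ℝ := 4 / (9 * Real.pi ^ 2) with hc
  have hc0 : 0 < c := by positivity
  have hc1 : c ≤ 1 := by
    rw [hc, div_le_one (by positivity)]
    nlinarith
  -- The factor `2 / c + 2` bounds `M` including its rounding, `9 / 4` comes from `M * (3 * 3 ^ L) /
  -- 4` with `3 ^ L ≤ 3 * √n`, and the last `2` pays for the initial evaluation.
  refine ⟨9 / 4 * (2 / c + 2) + 2, by positivity, fun n hn δ hδ0 hδ => ?_⟩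
  have hlog : 1 / 2 ≤ Real.log (1 / δ) := by
    have h2 : (2 : ℝ) ≤ 1 / δ := by rw [le_div_iff₀ hδ0]; linarith
    linarith [Real.log_le_log two_pos h2, Real.log_two_gt_d9]
  have hlog2 : Real.log (2 / δ) ≤ 2 * Real.log (1 / δ) := by
    have h2 : (2 : ℝ) ≤ 1 / δ := by rw [le_div_iff₀ hδ0]; linarith
    have : (2 : ℝ) / δ = 2 * (1 / δ) := by ring
    rw [this, Real.log_mul two_ne_zero (by positivity)]
    linarith [Real.log_le_log two_pos h2]
  -- `M` is chosen so that `q = (1 - c) ^ M ≤ δ / 2`, since the schedule loses at most `2 * q`.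
  have hsqrt : 1 ≤ √(n : ℝ) := Real.one_le_sqrt.mpr (by exact_mod_cast hn)
  set M := ⌈Real.log (2 / δ) / c⌉₊ with hM
  have hM1 : (M : ℝ) ≤ (2 / c + 2) * Real.log (1 / δ) := by
    have hpos : 0 ≤ Real.log (2 / δ) / c :=
      div_nonneg (Real.log_nonneg (by rw [le_div_iff₀ hδ0]; linarith)) hc0.le
    have h1 := (Nat.ceil_lt_add_one hpos).le
    have h2 : Real.log (2 / δ) / c ≤ 2 * Real.log (1 / δ) / c := by gcongr
    calc (M : ℝ) ≤ 2 * Real.log (1 / δ) / c + 2 * Real.log (1 / δ) := by linarith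
      _ = _ := by ring
  have hq : (1 - c) ^ M ≤ δ / 2 := by
    have h1 : Real.log (2 / δ) ≤ c * M := by
      rw [mul_comm, ← div_le_iff₀ hc0]
      exact Nat.le_ceil _
    calc (1 - c) ^ M ≤ Real.exp (-c) ^ M :=
          pow_le_pow_left₀ (by linarith) (Real.one_sub_le_exp_neg c) M
      _ = Real.exp (-(c * M)) := by rw [← Real.exp_nat_mul]; ring_nf
      _ ≤ Real.exp (-Real.log (2 / δ)) := Real.exp_le_exp.mpr (by linarith)
      _ = δ / 2 := by rw [Real.exp_neg, Real.exp_log (by positivity), inv_div]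
  set L := Nat.clog 9 n with hL
  have h3L : (3 : ℝ) ^ L ≤ 3 * √n := by
    rcases Nat.lt_or_ge 1 n with h1 | h1
    · have hlt := Nat.pow_pred_clog_lt_self (by norm_num : 1 < 9) h1
      rw [← hL] at hlt
      have hL0 : L ≠ 0 := (Nat.clog_pos (by norm_num) h1).ne'
      obtain ⟨a, ha⟩ := Nat.exists_eq_succ_of_ne_zero hL0
      rw [ha] at hlt ⊢
      rw [Nat.pred_succ] at hlt
      have : (3 : ℝ) ^ a ≤ √n := by
        refine Real.le_sqrt_of_sq_le ?_
        rw [← pow_mul, mul_comm, pow_mul]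
        norm_num
        exact_mod_cast hlt.le
      rw [pow_succ]
      linarith
    · have : L = 0 := Nat.clog_of_right_le_one h1 9
      rw [this, pow_zero]
      linarith
  refine ⟨schedule M L 0, ?_, fun h i => ?_⟩
  · have hsum := sum_schedule M L 0
    have hle : 4 * ((schedule M L 0).map fun k => 2 * k + 1).sum ≤ M * (3 * 3 ^ L) := by
      rw [pow_zero, mul_one, pow_succ' 3 L] at hsum
      omega
    have hle' : 4 * ((((schedule M L 0).map fun k => 2 * k + 1).sum : ℕ) : ℝ) ≤
        M * (3 * 3 ^ L) := by exact_mod_cast hle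
    have h1 : (M : ℝ) * (3 * 3 ^ L) ≤
        ((2 / c + 2) * Real.log (1 / δ)) * (3 * (3 * √n)) := by gcongr
    have h2 : 1 ≤ 2 * (√n * Real.log (1 / δ)) := by nlinarith
    rw [Nat.cast_add, Nat.cast_one]
    calc ((((schedule M L 0).map fun k => 2 * k + 1).sum : ℕ) : ℝ) + 1
        ≤ ((2 / c + 2) * Real.log (1 / δ)) * (3 * (3 * √n)) / 4 +
          2 * (√n * Real.log (1 / δ)) := by linarith
      _ = _ := by ring
  · have hq0 : 0 ≤ (1 - c) ^ M := pow_nonneg (by linarith) M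
    have hmain := le_chainProb_schedule (h := h) rfl hq0 (by linarith) L 0
      (by rw [zero_add]; exact Nat.le_pow_clog (by norm_num) n) i
      (mem_topSet.mpr (by simpa using card_better_lt h i))
    have := pow_nonneg hq0 (L + 1)
    linarith

variable {d n : ℕ}

/-- The displacements of the query points that are needed for group `i`. -/
noncomputable def groupShift (g : Fin n → Finset (Fin d)) (σ : ℝ) (i : Fin n) (k : ℕ) :
    EuclideanSpace ℝ (Fin d) :=
  if hk : k < (g i).card then
    σ • EuclideanSpace.single ((g i).equivFin.symm ⟨k, hk⟩ : Fin d) (1 : ℝ)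
  else 0

/-- The gradient estimate on the group of the label, from the function values in its slots. -/
noncomputable def readGradient (g : Fin n → Finset (Fin d)) (σ : ℝ)
    (b : Registers d (SearchWork n)) : g b.2.2.1 → ℝ :=
  fun j => (b.2.2.2 ((g b.2.2.1).equivFin j) - b.2.2.2 (maxGroupSize g)) / σ

theorem card_le_maxGroupSize (g : Fin n → Finset (Fin d)) (i : Fin n) :
    (g i).card ≤ maxGroupSize g :=
  Finset.le_sup (f := fun i => (g i).card) (Finset.mem_univ i)

/-- Slot `maxGroupSize g` lies past the coordinates of every group, so its displacement is zero and
it always holds `f x`. This is why one slot more than the largest group size is used. -/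
theorem readGradient_filledLabel (g : Fin n → Finset (Fin d)) (σ : ℝ)
    (f : EuclideanSpace ℝ (Fin d) → ℝ) (x : EuclideanSpace ℝ (Fin d)) (i : Fin n) :
    readGradient g σ (filledLabel (groupShift g σ) f (maxGroupSize g + 1) x i) =
      restrictTo (g i) (forwardDiff f σ x) := by
  refine funext fun (j : g i) => ?_
  have hcard := card_le_maxGroupSize g i
  have hj := ((g i).equivFin j).isLt
  have h1 : ((g i).equivFin j : ℕ) ≤ maxGroupSize g := by omega
  have h2 : ¬ maxGroupSize g < (g i).card := by omega
  have h3 : (g i).equivFin.symm ((g i).equivFin j) = j := Equiv.symm_apply_apply _ j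
  change ((if ((g i).equivFin j : ℕ) < maxGroupSize g + 1 then
      f (x + groupShift g σ i ((g i).equivFin j)) else 0) -
    (if maxGroupSize g < maxGroupSize g + 1 then
      f (x + groupShift g σ i (maxGroupSize g)) else 0)) / σ =
    (f (x + σ • EuclideanSpace.single (j : Fin d) (1 : ℝ)) - f x) / σ
  simp [groupShift, h1, h2, h3]

/-- Some quantum algorithm returns, with high probability, an optimal dual vector of a group of
greatest dual norm. -/
theorem exists_algorithm_dual_vector : ∃ C : ℝ, 0 < C ∧
    ∀ (d n : ℕ) (g : Fin n → Finset (Fin d)) (p : Fin n → ℝ≥0∞), 0 < n →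
      (∀ j : Fin d, ∃ i : Fin n, j ∈ g i) → (∀ i : Fin n, 1 ≤ p i) →
      ∀ σ δ : ℝ, 0 < δ → δ ≤ 1 / 2 →
        ∃ (A : QAlgorithm d (EuclideanSpace ℝ (Fin d))) (T : ℕ),
          A.queries ≤ (T : ℕ∞) ∧
          (T : ℝ) ≤ C * (√n * maxGroupSize g * Real.log (1 / δ)) ∧
          ∀ (f : EuclideanSpace ℝ (Fin d) → ℝ) (x : EuclideanSpace ℝ (Fin d))
            (S : Set (EuclideanSpace ℝ (Fin d))),
            (∀ (i : Fin n) (v : g i → ℝ),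
              (∀ k, groupDualNorm (g k) (p k) (restrictTo (g k) (forwardDiff f σ x)) ≤
                groupDualNorm (g i) (p i) (restrictTo (g i) (forwardDiff f σ x))) →
              groupNorm (g i) (p i) v ≤ 1 →
              ∑ j, v j * restrictTo (g i) (forwardDiff f σ x) j =
                groupDualNorm (g i) (p i) (restrictTo (g i) (forwardDiff f σ x)) →
              extendZero (g i) v ∈ S) →
            ENNReal.ofReal (1 - δ) ≤ A.prob f x S := by
  obtain ⟨C, hC, hsched⟩ := exists_schedule
  refine ⟨2 * C, by positivity, fun d n g p hn hg hp σ δ hδ0 hδ => ?_⟩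
  choose dual hdual1 hdual2 _ using fun (i : Fin n) (y : g i → ℝ) =>
    exists_isGreatest_groupDualNorm (g i) (hp i) y
  obtain ⟨ks, hks, hprob⟩ := hsched n hn δ hδ0 hδ
  set score : Registers d (SearchWork n) → ℝ := fun b =>
    groupDualNorm (g b.2.2.1) (p b.2.2.1) (readGradient g σ b)
  set out : Registers d (SearchWork n) → EuclideanSpace ℝ (Fin d) := fun b =>
    extendZero (g b.2.2.1) (dual b.2.2.1 (readGradient g σ b))
  have hscore : ∀ f x i, score (filledLabel (groupShift g σ) f (maxGroupSize g + 1) x i) =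
      groupDualNorm (g i) (p i) (restrictTo (g i) (forwardDiff f σ x)) := fun f x i => by
    rw [← readGradient_filledLabel]
    rfl
  have hout : ∀ f x i, out (filledLabel (groupShift g σ) f (maxGroupSize g + 1) x i) =
      extendZero (g i) (dual i (restrictTo (g i) (forwardDiff f σ x))) := fun f x i => by
    rw [← readGradient_filledLabel]
    rfl
  -- If all groups are empty then `d = 0` and the bound allows no query, so a query-free program is
  -- needed. Otherwise `maxGroupSize g + 1 ≤ 2 * maxGroupSize g`, which costs the factor `2` in the
  -- constant.
  rcases Nat.eq_zero_or_pos (maxGroupSize g) with h0 | hpos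
  · have hE : IsEmpty (Fin d) := ⟨fun j => by
      obtain ⟨i, hi⟩ := hg j
      have := card_le_maxGroupSize g i
      have := Finset.card_pos.mpr ⟨j, hi⟩
      omega⟩
    refine ⟨⟨Unit, (), .done fun _ => 0⟩, 0, le_rfl, by simp [h0], fun f x S hS => ?_⟩
    have h0S : (0 : EuclideanSpace ℝ (Fin d)) ∈ S := by
      have : Nonempty (Fin n) := ⟨⟨0, hn⟩⟩
      obtain ⟨i, hi⟩ := Finite.exists_max fun i : Fin n =>
        groupDualNorm (g i) (p i) (restrictTo (g i) (forwardDiff f σ x))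
      have := hS i _ hi (hdual1 i _) (hdual2 i _)
      rwa [Subsingleton.elim (extendZero (g i) _) 0] at this
    simp only [QAlgorithm.prob, QProgram.prob, h0S, if_true]
    refine le_trans ?_ (ENNReal.le_tsum (x, 0, ()))
    rw [basisState_apply_self]
    simp [hδ0.le]
  · refine ⟨maxSearchAlgorithm (groupShift g σ) score out hn (maxGroupSize g + 1) ks, _,
      queries_maxSearchAlgorithm_le _ score out hn _ ks, ?_, fun f x S hS => ?_⟩
    · have hm : ((maxGroupSize g + 1 : ℕ) : ℝ) ≤ 2 * maxGroupSize g := by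
        exact_mod_cast (by omega : maxGroupSize g + 1 ≤ 2 * maxGroupSize g)
      rw [Nat.cast_mul]
      calc _ ≤ (2 * (maxGroupSize g : ℝ)) * (C * (√n * Real.log (1 / δ))) :=
            mul_le_mul hm hks (Nat.cast_nonneg _) (by positivity)
        _ = _ := by ring
    · refine (ENNReal.ofReal_le_ofReal (hprob _ _)).trans
        (le_prob_maxSearchAlgorithm (groupShift g σ) f S score out hn (maxGroupSize g + 1) ks x
          fun i hi => ?_)
      simp only [hscore] at hi
      rw [hout]
      exact hS i _ hi (hdual1 i _) (hdual2 i _)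

end FrankWolfe

theorem mainTheorem5 :
    ∃ C : ℝ, 0 < C ∧
      ∀ (d n : ℕ) (g : Fin n → Finset (Fin d)) (p : Fin n → ENNReal),
        0 < n → (∀ j : Fin d, ∃ i : Fin n, j ∈ g i) → (∀ i : Fin n, 1 ≤ p i) →
        (∀ y : EuclideanSpace ℝ (Fin d),
          IsGreatest (Set.range fun i : Fin n => groupDualNorm (g i) (p i) (restrictTo (g i) y))
            (latentGroupDualNorm g p y)) ∧
        ∀ σ δ : ℝ, 0 < σ → 0 < δ → δ ≤ 1 / 2 →
          ∃ (A : QAlgorithm d (EuclideanSpace ℝ (Fin d))) (T : ℕ),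
            A.queries ≤ (T : ℕ∞) ∧
            (T : ℝ) ≤ C * (Real.sqrt n * maxGroupSize g * Real.log (1 / δ)) ∧
            ∀ (f : EuclideanSpace ℝ (Fin d) → ℝ) (x : EuclideanSpace ℝ (Fin d)),
              ENNReal.ofReal (1 - δ) ≤ A.prob f x
                {s | s ∈ latentGroupBall g p ∧
                  IsMaxOn (fun s' => inner ℝ s' (forwardDiff f σ x)) (latentGroupBall g p) s} ∧
              (HasGradientAt f (forwardDiff f σ x) x →
                ENNReal.ofReal (1 - δ) ≤ A.prob f x
                  {s | s ∈ latentGroupBall g p ∧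
                    inner ℝ s (gradient f x) = latentGroupDualNorm g p (gradient f x) ∧
                    -s ∈ latentGroupBall g p ∧
                    IsMinOn (fun s' => inner ℝ s' (gradient f x)) (latentGroupBall g p) (-s)}) := by
  obtain ⟨C, hC, halg⟩ := exists_algorithm_dual_vector
  refine ⟨C, hC, fun d n g p hn hg hp => ⟨isGreatest_latentGroupDualNorm g hn hg hp,
    fun σ δ _ hδ0 hδ => ?_⟩⟩
  obtain ⟨A, T, hA, hT, hS⟩ := halg d n g p hn hg hp σ δ hδ0 hδ
  -- One algorithm serves both claims because its guarantee holds for every set `S` that contains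
  -- all optimal dual vectors.
  refine ⟨A, T, hA, hT, fun f x => ⟨hS f x _ fun i v hi hv hvy => ?_, fun hgrad =>
    hS f x _ fun i v hi hv hvy => ?_⟩⟩
  · obtain ⟨h1, h2, h3⟩ := isGreatest_inner_extendZero g hg hp _ hi hv hvy
    exact ⟨h1, fun s hs => (h3.2 ⟨s, hs, rfl⟩).trans h2.ge⟩
  · obtain ⟨h1, h2, h3⟩ := isGreatest_inner_extendZero g hg hp _ hi hv hvy
    rw [hgrad.gradient]
    refine ⟨h1, h2.trans h3.csSup_eq.symm, ?_, fun s hs => ?_⟩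
    · exact (latentGroupNorm_neg g hp _).trans_le h1
    · have h4 : inner ℝ (-s) (forwardDiff f σ x) ≤ _ :=
        h3.2 ⟨-s, (latentGroupNorm_neg g hp s).trans_le hs, rfl⟩
      change inner ℝ (-extendZero (g i) v) _ ≤ inner ℝ s _
      rw [inner_neg_left] at h4 ⊢
      rw [h2]
      linarith
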